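/- Let $G$ be a countable (discrete) nilpotent group, let $T\colon G\curvearrowright (X,\mu)$ be a measurable, probability-preserving action on a standard Borel probability space, so that $T^{gh}=T^gT^h$ for $g,h\in G$, and let $p_1,\dots,p_k\colon\mathbb{Z}\to G$ be polynomial sequences. Here, for $p\colon\mathbb{Z}\to G$ and $m\in\mathbb{Z}$, put $D_mp(n):=p(n+m)^{-1}p(n)$; the sequence $p$ is called polynomial if there is an integer $d\ge 0$ such that $D_{m_1}D_{m_2}\cdots D_{m_d}p$ is identically $e$ for all $m_1,\dots,m_d\in\mathbb{Z}$. Then for all (real- or complex-valued) $f_1,\dots,f_k\in L^\infty(\mu)$ the averages \[\frac1N\sum_{n=1}^N (f_1\circ T^{p_1(n)})(f_2\circ T^{p_2(n)})\cdots(f_k\circ T^{p_k(n)})\] converge in the norm of $L^2(\mu)$ as $N\to\infty$. -/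

import Mathlib

open MeasureTheory Filter Topology
open scoped ENNReal

/-- The discrete derivative `D_m p (n) = p (n + m)⁻¹ * p n` of a sequence in a group. -/
def seqDeriv {G : Type*} [Group G] (m : ℤ) (p : ℤ → G) : ℤ → G :=
  fun n => (p (n + m))⁻¹ * p n

/-- The iterated derivative `D_{m₁} D_{m₂} ⋯ D_{m_d} p` along a list `[m₁, …, m_d]`. -/
def iterSeqDeriv {G : Type*} [Group G] (l : List ℤ) (p : ℤ → G) : ℤ → G :=
  l.foldr seqDeriv p

/-- A sequence `p : ℤ → G` is polynomial if, for some `d`, all its iterated derivatives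
`D_{m₁} ⋯ D_{m_d} p` of order `d` are identically `1`. -/
def IsPolynomialSeq {G : Type*} [Group G] (p : ℤ → G) : Prop :=
  ∃ d : ℕ, ∀ l : List ℤ, l.length = d → iterSeqDeriv l p = 1

/-- The averages `x ↦ (1/N) ∑_{n = 1}^N ∏_i f_i (T^{p_i(n)} x)`, where `T^g x = g • x`. -/
noncomputable def nonconvAverage {𝕜 G X : Type*} [RCLike 𝕜] [Group G] [MulAction G X]
    {k : ℕ} (p : Fin k → ℤ → G) (f : Fin k → X → 𝕜) (N : ℕ) : X → 𝕜 :=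
  fun x => (N : 𝕜)⁻¹ * ∑ n ∈ Finset.Icc 1 N, ∏ i, f i (p i (n : ℤ) • x)

/-!
The proof follows Walsh's finitary method, with an energy decrement in place of the Hahn–Banach
theorem.

Fix one of the sequences, the pivot `p`, with function `f`, and let `u` be the average of the system
at time `N`. If `u` is large in `L²`, then `f` correlates with the *dual function* `σ` of `u`, and
subtracting `σ` from `f` lowers the energy `‖f‖₂²` by at least `‖u‖₂²` (`energy_sub_dualFn_le`). On
time scales much shorter than `N`, the translates `σ ∘ p(l)` are averages over `m ≤ N` of products
involving the sequences `q(l + m) p(l + m)⁻¹ p(l)`, so that the averages of the system with `σ` in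
place of `f` are close to averages over `m` of multiple averages of *reduced systems*
(`norm_pivotAvg_dualFn_sub_le`). After boundedly many subtractions `f` is the sum of a part with
small averages and a part governed by reduced systems (`exists_structured_decomposition`), which are
dealt with by induction on the number `d` of reductions needed to reach constant sequences
(`HasComplexity`).

For this induction, convergence must be uniform over all reduced systems, so it is replaced by
*uniform metastability* (`UniformlyMetastable`): averages are stable on some interval `[M, F M]`,
where `M` is bounded independently of the system. It is formulated for finite weighted families of
systems, because all steps `m` have to be treated at once. Applied to a single system, with `F M`
chosen beyond a pair of times that violate the Cauchy condition after `M`, it gives convergence.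

It remains to see that polynomial sequences in a nilpotent group have finite complexity. They are
adapted to a filtration `Γ` (`exists_filtration_of_isPolynomialSeq`), and the sequences of order
`j ≥ 1` form groups `polySet Γ j` whose commutators add orders
(`polySet_commutator_and_group`). Hence if `q` is congruent to the pivot modulo `polySet Γ j`, then
the new sequence `q(n + m) p(n + m)⁻¹ p(n)` is congruent to `q` modulo `polySet Γ (j + 1)`
(`redSeq_congr`). So reductions at pivots in one congruence class do not create classes at the same
level, and classes can be eliminated one by one (`uniformComplexity_of_avoiding`,
`exists_hasComplexity_of_subset_polySet`).
-/

/-! ### Polynomial sequences adapted to a filtration -/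

/-- The three subgroups lemma relative to a normal subgroup. -/
theorem Subgroup.commutator_commutator_le_of_rotate {G : Type*} [Group G]
    {H₁ H₂ H₃ N : Subgroup G} [N.Normal] (h1 : ⁅⁅H₂, H₃⁆, H₁⁆ ≤ N) (h2 : ⁅⁅H₃, H₁⁆, H₂⁆ ≤ N) :
    ⁅⁅H₁, H₂⁆, H₃⁆ ≤ N := by
  have key : ∀ K : Subgroup G, K ≤ N ↔ K.map (QuotientGroup.mk' N) = ⊥ := fun K => by
    rw [Subgroup.map_eq_bot_iff, QuotientGroup.ker_mk']
  rw [key] at h1 h2 ⊢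
  simp only [Subgroup.map_commutator] at h1 h2 ⊢
  exact Subgroup.commutator_commutator_eq_bot_of_rotate h1 h2

theorem Subgroup.commutator_lowerCentralSeries_le {G : Type*} [Group G] (a b : ℕ) :
    ⁅(⊤ : Subgroup G).lowerCentralSeries a, (⊤ : Subgroup G).lowerCentralSeries b⁆ ≤
      (⊤ : Subgroup G).lowerCentralSeries (a + b + 1) := by
  induction b generalizing a with
  | zero => simp
  | succ b ih =>
    rw [Subgroup.lowerCentralSeries_succ _ b, Subgroup.commutator_comm]
    apply Subgroup.commutator_commutator_le_of_rotate
    · rw [Subgroup.commutator_comm ⊤, ← Subgroup.lowerCentralSeries_succ]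
      exact (ih (a + 1)).trans_eq (by congr 1; omega)
    · exact Subgroup.commutator_mono (ih a) le_rfl

/-- A finite-length filtration: a decreasing sequence of subgroups with
`⁅Γ i, Γ j⁆ ≤ Γ (i + j)` and `Γ L = ⊥`. The term `Γ 0` is not required to be the whole group. -/
structure IsCommFiltration {G : Type*} [Group G] (Γ : ℕ → Subgroup G) (L : ℕ) : Prop where
  antitone : Antitone Γ
  commutator_le : ∀ i j, ⁅Γ i, Γ j⁆ ≤ Γ (i + j)
  eq_bot : Γ L = ⊥

/-- The sequences adapted to the filtration `Γ` shifted by `j`: every derivative of order `i`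
takes values in `Γ (i + j)`. -/
def polySet {G : Type*} [Group G] (Γ : ℕ → Subgroup G) (j : ℕ) : Set (ℤ → G) :=
  {p | ∀ (l : List ℤ) (n : ℤ), iterSeqDeriv l p n ∈ Γ (j + l.length)}

section polySet

variable {G : Type*} [Group G] {Γ : ℕ → Subgroup G} {L : ℕ}

theorem mem_polySet_iff {j : ℕ} {p : ℤ → G} :
    p ∈ polySet Γ j ↔ (∀ n, p n ∈ Γ j) ∧ ∀ m, seqDeriv m p ∈ polySet Γ (j + 1) := by
  constructor
  · refine fun h => ⟨fun n => h [] n, fun m l n => ?_⟩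
    have := h (l ++ [m]) n
    simp only [iterSeqDeriv, List.foldr_append, List.foldr_cons, List.foldr_nil,
      List.length_append, List.length_cons, List.length_nil] at this ⊢
    convert this using 2
    omega
  · rintro ⟨h0, h1⟩ l n
    rcases l.eq_nil_or_concat with rfl | ⟨l, m, rfl⟩
    · exact h0 n
    · have := h1 m l n
      simp only [iterSeqDeriv, List.foldr_append, List.foldr_cons, List.foldr_nil,
        List.length_append, List.length_cons, List.length_nil, List.concat_eq_append] at this ⊢
      convert this using 2
      omega

theorem polySet_antitone (hΓ : IsCommFiltration Γ L) : Antitone (polySet Γ) :=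
  fun _ _ hij _ hp l n => hΓ.antitone (by omega) (hp l n)

theorem seqDeriv_mem_polySet {j : ℕ} {p : ℤ → G} (hp : p ∈ polySet Γ j) (m : ℤ) :
    seqDeriv m p ∈ polySet Γ (j + 1) :=
  (mem_polySet_iff.1 hp).2 m

theorem iterSeqDeriv_shift (l : List ℤ) (p : ℤ → G) (m n : ℤ) :
    iterSeqDeriv l (fun n => p (n + m)) n = iterSeqDeriv l p (n + m) := by
  induction l generalizing n with
  | nil => rfl
  | cons a l ih =>
    change (iterSeqDeriv l _ (n + a))⁻¹ * iterSeqDeriv l _ n =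
      (iterSeqDeriv l _ (n + m + a))⁻¹ * iterSeqDeriv l _ (n + m)
    rw [ih, ih, add_right_comm]

theorem shift_mem_polySet {j : ℕ} {p : ℤ → G} (hp : p ∈ polySet Γ j) (m : ℤ) :
    (fun n => p (n + m)) ∈ polySet Γ j := fun l n => by
  rw [iterSeqDeriv_shift]; exact hp l _

theorem iterSeqDeriv_one (l : List ℤ) : iterSeqDeriv l (1 : ℤ → G) = 1 := by
  induction l with
  | nil => rfl
  | cons a l ih =>
    change seqDeriv a (iterSeqDeriv l 1) = 1
    rw [ih]; funext n; simp [seqDeriv]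

theorem one_mem_polySet (j : ℕ) : (1 : ℤ → G) ∈ polySet Γ j := fun l n => by
  rw [iterSeqDeriv_one]; exact one_mem _

theorem eq_one_of_mem_polySet (hΓ : IsCommFiltration Γ L) {j : ℕ} (hj : L ≤ j) {p : ℤ → G}
    (hp : p ∈ polySet Γ j) : p = 1 := by
  funext n
  have := hΓ.antitone hj (hp [] n)
  rwa [hΓ.eq_bot, Subgroup.mem_bot] at this

/-- The Lazard–Leibman theorem: for positive orders, `polySet Γ s` is a group, and commutators add
orders. All parts are proved together by downward induction on `s`: modulo `polySet Γ (s + 1)` the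
commutator of two sequences of total order `s` is shift invariant, and the derivative of a product
is the product of the derivatives up to a commutator. Order `0` is excluded, because inverting a
conjugation uses that commutators with the conjugating sequence have strictly larger order. -/
theorem polySet_commutator_and_group (hΓ : IsCommFiltration Γ L) (s : ℕ) (hs : 1 ≤ s) :
    (∀ i j, 1 ≤ i → 1 ≤ j → i + j = s → ∀ p ∈ polySet Γ i, ∀ q ∈ polySet Γ j,
      p * q * p⁻¹ * q⁻¹ ∈ polySet Γ s) ∧
    (∀ p ∈ polySet Γ s, ∀ q ∈ polySet Γ s, p * q ∈ polySet Γ s) ∧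
    (∀ p ∈ polySet Γ s, p⁻¹ ∈ polySet Γ s) ∧
    (∀ k, 1 ≤ k → ∀ x ∈ polySet Γ s, ∀ y ∈ polySet Γ k, y⁻¹ * x * y ∈ polySet Γ s) := by
  induction hk : L - s using Nat.strong_induction_on generalizing s with
  | _ k ih =>
  rcases le_or_gt L s with hL | hL
  · have h1 : ∀ p ∈ polySet Γ s, p = 1 := fun p hp => eq_one_of_mem_polySet hΓ hL hp
    refine ⟨fun i j _ _ hij p hp q hq => ?_, fun p hp q hq => ?_, fun p hp => ?_,
      fun k _ x hx y _ => ?_⟩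
    · have : p * q * p⁻¹ * q⁻¹ = 1 := by
        funext n
        have := hΓ.commutator_le i j (Subgroup.commutator_mem_commutator (hp [] n) (hq [] n))
        have := hΓ.antitone (hL.trans_eq hij.symm) this
        rw [hΓ.eq_bot, Subgroup.mem_bot] at this
        exact this
      rw [this]; exact one_mem_polySet _
    · rw [h1 p hp, h1 q hq, one_mul]; exact one_mem_polySet _
    · rw [h1 p hp, inv_one]; exact one_mem_polySet _
    · rw [h1 x hx]; simpa using one_mem_polySet _
  have IH := fun t (ht : s < t) => ih (L - t) (by omega) t (by omega) rfl
  obtain ⟨-, hmul, hinv, hconj'⟩ := IH (s + 1) (by omega)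
  have hcomm : ∀ i j, 1 ≤ i → 1 ≤ j → s + 1 ≤ i + j → ∀ p ∈ polySet Γ i, ∀ q ∈ polySet Γ j,
      p * q * p⁻¹ * q⁻¹ ∈ polySet Γ (s + 1) := fun i j hi hj hij p hp q hq =>
    polySet_antitone hΓ hij ((IH (i + j) (by omega)).1 i j hi hj rfl p hp q hq)
  have hconj : ∀ k, 1 ≤ k → ∀ x ∈ polySet Γ (s + 1), ∀ y ∈ polySet Γ k,
      y * x * y⁻¹ ∈ polySet Γ (s + 1) := fun k hk x hx y hy => by
    have : y * x * y⁻¹ = (y * x * y⁻¹ * x⁻¹) * x := by simp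
    rw [this]
    exact hmul _ (hcomm k (s + 1) hk (by omega) (by omega) y hy x hx) _ hx
  have hmul_s : ∀ p ∈ polySet Γ s, ∀ q ∈ polySet Γ s, p * q ∈ polySet Γ s := by
    intro p hp q hq
    refine mem_polySet_iff.2 ⟨fun n => mul_mem (hp [] n) (hq [] n), fun m => ?_⟩
    have : seqDeriv m (p * q) =
        (fun n => q (n + m))⁻¹ * seqDeriv m p * (fun n => q (n + m)) * seqDeriv m q := by
      funext n; simp [seqDeriv, mul_assoc]
    rw [this]
    exact hmul _ (hconj' s hs _ (seqDeriv_mem_polySet hp m) _ (shift_mem_polySet hq m)) _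
      (seqDeriv_mem_polySet hq m)
  have hinv_s : ∀ p ∈ polySet Γ s, p⁻¹ ∈ polySet Γ s := by
    intro p hp
    refine mem_polySet_iff.2 ⟨fun n => inv_mem (hp [] n), fun m => ?_⟩
    have : seqDeriv m p⁻¹ = p * (seqDeriv m p)⁻¹ * p⁻¹ := by
      funext n; simp [seqDeriv]
    rw [this]
    exact hconj s hs _ (hinv _ (seqDeriv_mem_polySet hp m)) _ hp
  refine ⟨fun i j hi hj hij p hp q hq => ?_, hmul_s, hinv_s, fun k hk x hx y hy => ?_⟩
  · refine mem_polySet_iff.2 ⟨fun n => ?_, fun m => ?_⟩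
    · rw [← hij]
      exact hΓ.commutator_le i j (Subgroup.commutator_mem_commutator (hp [] n) (hq [] n))
    · set p' : ℤ → G := fun n => p (n + m) with hp'
      set q' : ℤ → G := fun n => q (n + m) with hq'
      have hp'm : p' ∈ polySet Γ i := shift_mem_polySet hp m
      have hq'm : q' ∈ polySet Γ j := shift_mem_polySet hq m
      set a := seqDeriv m p with ha
      set b := seqDeriv m q with hb
      have ham : a ∈ polySet Γ (i + 1) := seqDeriv_mem_polySet hp m
      have hbm : b ∈ polySet Γ (j + 1) := seqDeriv_mem_polySet hq m
      have hpa : p = p' * a := by funext n; simp [hp', ha, seqDeriv]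
      have hqb : q = q' * b := by funext n; simp [hq', hb, seqDeriv]
      -- `⁅p, q⁆ = x * ⁅p', q'⁆ * y` with `x` and `y` of order `s + 1`
      have hx := hconj i hi _ (hcomm (i + 1) j (by omega) hj (by omega) a ham q hq) p' hp'm
      have hy := hconj j hj _ (hcomm i (j + 1) hi (by omega) (by omega) p' hp'm b hbm) q' hq'm
      have key : seqDeriv m (p * q * p⁻¹ * q⁻¹) =
          (q' * (p' * (q'⁻¹ * (p'⁻¹ * (p' * (a * q * a⁻¹ * q⁻¹) * p'⁻¹) * p') * q') * p'⁻¹) *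
            q'⁻¹) * (q' * (p' * b * p'⁻¹ * b⁻¹) * q'⁻¹) := by
        have h0 : seqDeriv m (p * q * p⁻¹ * q⁻¹) =
            (p' * q' * p'⁻¹ * q'⁻¹)⁻¹ * (p * q * p⁻¹ * q⁻¹) := rfl
        rw [h0, hpa, hqb]
        group
      rw [key]
      exact hmul _ (hconj j hj _ (hconj i hi _ (hconj' j hj _ (hconj' i hi _ hx _ hp'm) _ hq'm)
        _ hp'm) _ hq'm) _ hy
  · -- conjugation by `y⁻¹` inverts conjugation by `y`, which is trivial modulo higher order
    have hz : x⁻¹ * y * x⁻¹⁻¹ * y⁻¹ ∈ polySet Γ (s + 1) :=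
      hcomm s k hs hk (by omega) _ (hinv_s x hx) y hy
    have : y⁻¹ * x * y = x * (y⁻¹ * (x⁻¹ * y * x⁻¹⁻¹ * y⁻¹) * y)⁻¹ := by group
    rw [this]
    exact hmul_s _ hx _ (hinv_s _ (polySet_antitone hΓ (Nat.le_succ s) (hconj' k hk _ hz y hy)))

theorem mul_mem_polySet (hΓ : IsCommFiltration Γ L) {s : ℕ} (hs : 1 ≤ s) {p q : ℤ → G}
    (hp : p ∈ polySet Γ s) (hq : q ∈ polySet Γ s) : p * q ∈ polySet Γ s :=
  (polySet_commutator_and_group hΓ s hs).2.1 p hp q hq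

theorem inv_mem_polySet (hΓ : IsCommFiltration Γ L) {s : ℕ} (hs : 1 ≤ s) {p : ℤ → G}
    (hp : p ∈ polySet Γ s) : p⁻¹ ∈ polySet Γ s :=
  (polySet_commutator_and_group hΓ s hs).2.2.1 p hp

theorem mul_mem_polySet_zero (hΓ : IsCommFiltration Γ L) {p q : ℤ → G}
    (hp : p ∈ polySet Γ 0) (hq : q ∈ polySet Γ 1) : p * q ∈ polySet Γ 0 := by
  refine mem_polySet_iff.2 ⟨fun n => mul_mem (hp [] n) (hΓ.antitone zero_le_one (hq [] n)),
    fun m => ?_⟩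
  have : seqDeriv m (p * q) =
      (fun n => q (n + m))⁻¹ * seqDeriv m p * (fun n => q (n + m)) * seqDeriv m q := by
    funext n; simp [seqDeriv, mul_assoc]
  rw [this]
  have hq' := shift_mem_polySet hq m
  exact mul_mem_polySet hΓ le_rfl (mul_mem_polySet hΓ le_rfl (mul_mem_polySet hΓ le_rfl
    (inv_mem_polySet hΓ le_rfl hq') (seqDeriv_mem_polySet hp m)) hq')
    (polySet_antitone hΓ one_le_two (seqDeriv_mem_polySet hq m))

/-- If `q⁻¹ * p` has order `j ≥ 1`, then the derivatives of `p` and `q` agree to order `j + 1`. -/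
theorem seqDeriv_inv_mul_mem_polySet (hΓ : IsCommFiltration Γ L) {j : ℕ} (hj : 1 ≤ j)
    {p q : ℤ → G} (hq : q ∈ polySet Γ 0) (hpq : q⁻¹ * p ∈ polySet Γ j) (m : ℤ) :
    (seqDeriv m q)⁻¹ * seqDeriv m p ∈ polySet Γ (j + 1) := by
  set r := q⁻¹ * p with hr
  have hr' : (fun n => r (n + m)) ∈ polySet Γ j := shift_mem_polySet hpq m
  have hD : (seqDeriv m q)⁻¹ ∈ polySet Γ 1 :=
    inv_mem_polySet hΓ le_rfl (seqDeriv_mem_polySet hq m)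
  have key : (seqDeriv m q)⁻¹ * seqDeriv m p =
      ((seqDeriv m q)⁻¹ * (fun n => r (n + m))⁻¹ * (seqDeriv m q)⁻¹⁻¹ * (fun n => r (n + m))⁻¹⁻¹) *
        seqDeriv m r := by
    funext n; simp [hr, seqDeriv, mul_assoc]
  rw [key]
  have := (polySet_commutator_and_group hΓ (1 + j) (by omega)).1 1 j le_rfl hj rfl _ hD _
    (inv_mem_polySet hΓ hj hr')
  rw [add_comm 1 j] at this
  exact mul_mem_polySet hΓ (by omega) this (seqDeriv_mem_polySet hpq m)

end polySet

/-- Finitely many polynomial sequences in a nilpotent group are adapted to a common filtration: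
if all derivatives of order `d` vanish, repeat every term of the lower central series `d` times. -/
theorem exists_filtration_of_isPolynomialSeq {G : Type*} [Group G] [Group.IsNilpotent G]
    {k : ℕ} (p : Fin k → ℤ → G) (hp : ∀ i, IsPolynomialSeq (p i)) :
    ∃ (Γ : ℕ → Subgroup G) (L : ℕ), IsCommFiltration Γ L ∧ ∀ i, p i ∈ polySet Γ 0 := by
  choose d hd using hp
  set D := ∑ i, d i + 1 with hD
  have hD0 : 0 < D := by omega
  obtain ⟨c, hc⟩ := Subgroup.nilpotent_iff_lowerCentralSeries.1
    (inferInstance : Group.IsNilpotent G)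
  have hanti := Subgroup.lowerCentralSeries_antitone (⊤ : Subgroup G)
  refine ⟨fun i => (⊤ : Subgroup G).lowerCentralSeries ((i - 1) / D), c * D + 1, ⟨?_, ?_, ?_⟩, ?_⟩
  · exact fun i j hij => hanti (Nat.div_le_div_right (by omega))
  · intro i j
    rcases Nat.eq_zero_or_pos i with rfl | hi
    · simpa using Subgroup.commutator_le_right _ _
    rcases Nat.eq_zero_or_pos j with rfl | hj
    · simpa using Subgroup.commutator_le_left _ _
    refine (Subgroup.commutator_lowerCentralSeries_le _ _).trans (hanti ?_)
    have h1 := Nat.div_add_mod (i - 1) D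
    have h2 := Nat.div_add_mod (j - 1) D
    have h3 := Nat.mod_lt (i - 1) hD0
    have h4 := Nat.mod_lt (j - 1) hD0
    rw [← Nat.lt_succ_iff, Nat.div_lt_iff_lt_mul hD0]
    have : ((i - 1) / D + (j - 1) / D + 1).succ * D =
      D * ((i - 1) / D) + D * ((j - 1) / D) + 2 * D := by rw [Nat.succ_eq_add_one]; ring
    omega
  · simp [Nat.mul_div_cancel _ hD0, hc]
  · intro i l n
    rcases le_or_gt l.length D with hl | hl
    · have : (0 + l.length - 1) / D = 0 := Nat.div_eq_of_lt (by omega)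
      simp only [this, Subgroup.lowerCentralSeries_zero, Subgroup.mem_top]
    · have hdi : d i ≤ l.length := by
        have := Finset.single_le_sum (f := d) (fun _ _ => Nat.zero_le _) (Finset.mem_univ i)
        omega
      have : iterSeqDeriv l (p i) =
          iterSeqDeriv (l.take (l.length - d i))
            (iterSeqDeriv (l.drop (l.length - d i)) (p i)) := by
        simp only [iterSeqDeriv]
        rw [← List.foldr_append, List.take_append_drop]
      rw [this, hd i _ (by rw [List.length_drop]; omega), iterSeqDeriv_one]
      exact one_mem _

/-! ### Reductions of systems and PET induction -/

/-- The sequence `n ↦ q (n + m) * p (n + m)⁻¹ * p n`: the factor of index `q` in the reduction of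
a system at the pivot `p`. -/
def redSeq {G : Type*} [Group G] (p : ℤ → G) (m : ℤ) (q : ℤ → G) : ℤ → G :=
  fun n => q (n + m) * (p (n + m))⁻¹ * p n

/-- The reduction of a system of sequences `S` at the pivot `p` and the step `m`: the pivot is
removed, and the sequences `redSeq p m q` for `q ≠ p` and the derivative of `p` are added. -/
def reduction {G : Type*} [Group G] (p : ℤ → G) (m : ℤ) (S : Set (ℤ → G)) : Set (ℤ → G) :=
  insert (seqDeriv m p) ((S \ {p}) ∪ redSeq p m '' (S \ {p}))

/-- `HasComplexity d S`: after `d` reductions with suitable pivots, and arbitrary steps, all the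
sequences of the system `S` are constant. The pivot may depend on the previous steps, and is not
required to belong to the system. -/
def HasComplexity {G : Type*} [Group G] : ℕ → Set (ℤ → G) → Prop
  | 0, S => ∀ q ∈ S, ∀ n, q n = q 0
  | d + 1, S => ∃ p, ∀ m, HasComplexity d (reduction p m S)

section Complexity

variable {G : Type*} [Group G] {Γ : ℕ → Subgroup G} {L : ℕ}

theorem HasComplexity.succ {d : ℕ} {S : Set (ℤ → G)} (h : HasComplexity d S) :
    HasComplexity (d + 1) S := by
  induction d generalizing S with
  | zero =>
    refine ⟨1, fun m => ?_⟩
    rintro q (rfl | hq | ⟨q, hq, rfl⟩) n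
    · simp [seqDeriv]
    · exact h q hq.1 n
    · simp only [redSeq, Pi.one_apply, inv_one, mul_one]
      rw [h q hq.1, h q hq.1 (0 + m)]
  | succ d ih =>
    obtain ⟨p, hp⟩ := h
    exact ⟨p, fun m => ih (hp m)⟩

theorem HasComplexity.mono {d e : ℕ} (hde : d ≤ e) {S : Set (ℤ → G)} (h : HasComplexity d S) :
    HasComplexity e S := by
  induction hde with
  | refl => exact h
  | step _ ih => exact ih.succ

theorem HasComplexity.subset {d : ℕ} {S S' : Set (ℤ → G)} (h : HasComplexity d S) (hS : S' ⊆ S) :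
    HasComplexity d S' := by
  induction d generalizing S S' with
  | zero => exact fun q hq => h q (hS hq)
  | succ d ih =>
    obtain ⟨p, hp⟩ := h
    have hS' : S' \ {p} ⊆ S \ {p} := Set.sdiff_subset_sdiff_left hS
    exact ⟨p, fun m => ih (hp m) (Set.insert_subset_insert
      (Set.union_subset_union hS' (Set.image_mono hS')))⟩

theorem encard_reduction_le {p : ℤ → G} {m : ℤ} {S : Set (ℤ → G)} {s : ℕ} (hS : S.encard ≤ s) :
    (reduction p m S).encard ≤ (2 * s + 1 : ℕ) := by
  have h1 : (S \ {p}).encard ≤ s := (Set.encard_le_encard Set.sdiff_subset).trans hS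
  calc (reduction p m S).encard ≤ ((S \ {p}) ∪ redSeq p m '' (S \ {p})).encard + 1 :=
        Set.encard_insert_le _ _
    _ ≤ ((S \ {p}).encard + (redSeq p m '' (S \ {p})).encard) + 1 := by
        gcongr; exact Set.encard_union_le _ _
    _ ≤ (s + s) + 1 := by
        gcongr; exact (Set.encard_image_le _ _).trans h1
    _ = (2 * s + 1 : ℕ) := by push_cast; ring

theorem mul_succ_mem_polySet (hΓ : IsCommFiltration Γ L) {k : ℕ} {p q : ℤ → G}
    (hp : p ∈ polySet Γ k) (hq : q ∈ polySet Γ (k + 1)) : p * q ∈ polySet Γ k := by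
  rcases Nat.eq_zero_or_pos k with rfl | hk
  · exact mul_mem_polySet_zero hΓ hp hq
  · exact mul_mem_polySet hΓ hk hp (polySet_antitone hΓ (Nat.le_succ k) hq)

/-- Sequences `q` and `p` are called congruent modulo `polySet Γ j` if `q⁻¹ * p ∈ polySet Γ j`; for
`1 ≤ j` this is an equivalence relation. -/
theorem polySet_congr_symm (hΓ : IsCommFiltration Γ L) {j : ℕ} (hj : 1 ≤ j) {p q : ℤ → G}
    (h : q⁻¹ * p ∈ polySet Γ j) : p⁻¹ * q ∈ polySet Γ j := by
  simpa using inv_mem_polySet hΓ hj h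

theorem polySet_congr_trans (hΓ : IsCommFiltration Γ L) {j : ℕ} (hj : 1 ≤ j) {p q r : ℤ → G}
    (h : p⁻¹ * q ∈ polySet Γ j) (h' : q⁻¹ * r ∈ polySet Γ j) : p⁻¹ * r ∈ polySet Γ j := by
  simpa [mul_assoc] using mul_mem_polySet hΓ hj h h'

theorem inv_mul_redSeq (p : ℤ → G) (m : ℤ) (q : ℤ → G) :
    q⁻¹ * redSeq p m q = (seqDeriv m q)⁻¹ * seqDeriv m p := by
  funext n; simp [redSeq, seqDeriv, mul_assoc]

theorem redSeq_congr_of_mem (hΓ : IsCommFiltration Γ L) {k : ℕ} {p q : ℤ → G}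
    (hp : p ∈ polySet Γ k) (hq : q ∈ polySet Γ k) (m : ℤ) :
    q⁻¹ * redSeq p m q ∈ polySet Γ (k + 1) := by
  rw [inv_mul_redSeq]
  exact mul_mem_polySet hΓ (by omega) (inv_mem_polySet hΓ (by omega) (seqDeriv_mem_polySet hq m))
    (seqDeriv_mem_polySet hp m)

theorem redSeq_mem_polySet (hΓ : IsCommFiltration Γ L) {k : ℕ} {p q : ℤ → G}
    (hp : p ∈ polySet Γ k) (hq : q ∈ polySet Γ k) (m : ℤ) : redSeq p m q ∈ polySet Γ k := by
  simpa using mul_succ_mem_polySet hΓ hq (redSeq_congr_of_mem hΓ hp hq m)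

theorem redSeq_congr (hΓ : IsCommFiltration Γ L) {j : ℕ} (hj : 1 ≤ j) {p q : ℤ → G}
    (hq : q ∈ polySet Γ 0) (h : q⁻¹ * p ∈ polySet Γ j) (m : ℤ) :
    q⁻¹ * redSeq p m q ∈ polySet Γ (j + 1) := by
  rw [inv_mul_redSeq]
  exact seqDeriv_inv_mul_mem_polySet hΓ hj hq h m

/-- Passing from `q` to `redSeq p m q` does not make a sequence closer to the pivot. -/
theorem congr_of_redSeq_congr (hΓ : IsCommFiltration Γ L) {j : ℕ} (hj : 1 ≤ j) {p q : ℤ → G}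
    (hp : p ∈ polySet Γ 0) (hq : q ∈ polySet Γ 0) {m : ℤ}
    (h : (redSeq p m q)⁻¹ * p ∈ polySet Γ j) : q⁻¹ * p ∈ polySet Γ j := by
  induction j, hj using Nat.le_induction with
  | base => exact polySet_congr_trans hΓ le_rfl (redSeq_congr_of_mem hΓ hp hq m) h
  | succ j hj ih =>
    have h1 := ih (polySet_antitone hΓ (Nat.le_succ j) h)
    exact polySet_congr_trans hΓ (by omega) (redSeq_congr hΓ hj hq h1 m) h

/-- A class of systems with marked sequences has uniformly bounded complexity if the complexity
of its systems is bounded in terms of their size. -/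
def UniformComplexity (Ψ : Set (Set (ℤ → G) × (ℤ → G))) : Prop :=
  ∀ s : ℕ, ∃ d, ∀ x ∈ Ψ, x.1.encard ≤ s → HasComplexity d x.1

/-- Elimination of a congruence class: let `Ψ` be a class of systems `S` with a marked sequence
`p`, closed under reductions at pivots congruent to `p` modulo `polySet Γ j`. If the systems in `Ψ`
that contain no sequence congruent to `p` have uniformly bounded complexity, then so do all systems
in `Ψ`. A single sequence (`j ≥ L`) is eliminated by one reduction. In general one eliminates,
one by one, the classes modulo `polySet Γ (j + 1)` that make up the class of `p`: a reduction at a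
pivot in one of them creates no new ones. -/
theorem uniformComplexity_of_avoiding (hΓ : IsCommFiltration Γ L) {j : ℕ} (hj : 1 ≤ j)
    {Ψ : Set (Set (ℤ → G) × (ℤ → G))}
    (hS : ∀ x ∈ Ψ, x.1 ⊆ polySet Γ 0)
    (hsep : ∀ x ∈ Ψ, ∀ p', p'⁻¹ * x.2 ∈ polySet Γ j →
      ∀ m, (seqDeriv m p')⁻¹ * x.2 ∉ polySet Γ j)
    (hstable : ∀ x ∈ Ψ, ∀ p' ∈ x.1, p'⁻¹ * x.2 ∈ polySet Γ j →
      ∀ m, (reduction p' m x.1, x.2) ∈ Ψ)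
    (havoid : UniformComplexity {x ∈ Ψ | ∀ q ∈ x.1, q⁻¹ * x.2 ∉ polySet Γ j}) :
    UniformComplexity Ψ := by
  induction hk : L - j generalizing j Ψ with
  | zero =>
    have heq : ∀ q p : ℤ → G, q⁻¹ * p ∈ polySet Γ j → q = p := fun q p h =>
      (inv_mul_eq_one.1 (eq_one_of_mem_polySet hΓ (by omega) h))
    have hself : ∀ p : ℤ → G, p⁻¹ * p ∈ polySet Γ j := fun p => by
      simpa using one_mem_polySet j
    intro s
    obtain ⟨d, hd⟩ := havoid (2 * s + 1)
    refine ⟨d + 1, fun ⟨S, p⟩ hx hs => ?_⟩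
    by_cases hp : p ∈ S
    · refine ⟨p, fun m => hd (reduction p m S, p) ⟨hstable _ hx p hp (hself p) m, ?_⟩
        (encard_reduction_le hs)⟩
      rintro q (rfl | hq | ⟨q, hq, rfl⟩) h
      · exact hsep _ hx p (hself p) m h
      · exact hq.2 (heq _ _ h)
      · exact hq.2 (heq _ _ (congr_of_redSeq_congr hΓ hj (hS _ hx hp) (hS _ hx hq.1) h))
    · refine (hd (S, p) ⟨hx, fun q hq h => hp ((show q = p from heq _ _ h) ▸ hq)⟩
        (hs.trans ?_)).succ
      exact_mod_cast (by omega : s ≤ 2 * s + 1)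
  | succ k ih =>
    have hj1 : 1 ≤ j + 1 := by omega
    have hmono : polySet Γ (j + 1) ⊆ polySet Γ j := polySet_antitone hΓ (Nat.le_succ j)
    -- induction on the number `t` of subclasses needed to cover the class of the marked sequence
    have main : ∀ t : ℕ, UniformComplexity {x ∈ Ψ | ∃ R : Finset (ℤ → G), R.card ≤ t ∧
        ∀ q ∈ x.1, q⁻¹ * x.2 ∈ polySet Γ j → ∃ r ∈ R, q⁻¹ * r ∈ polySet Γ (j + 1)} := by
      intro t
      induction t with
      | zero =>
        intro s
        obtain ⟨d, hd⟩ := havoid s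
        refine ⟨d, fun x hx hs => hd x ⟨hx.1, fun q hq h => ?_⟩ hs⟩
        obtain ⟨R, hR, hR'⟩ := hx.2
        obtain ⟨r, hr, -⟩ := hR' q hq h
        simp [Finset.card_eq_zero.1 (Nat.le_zero.1 hR)] at hr
      | succ t iht =>
        have hΨ' : UniformComplexity {y : Set (ℤ → G) × (ℤ → G) | ∃ p₀, (y.1, p₀) ∈ Ψ ∧
            y.2⁻¹ * p₀ ∈ polySet Γ j ∧ ∃ R : Finset (ℤ → G), R.card ≤ t ∧
            ∀ q ∈ y.1, q⁻¹ * p₀ ∈ polySet Γ j →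
              (∃ r ∈ R, q⁻¹ * r ∈ polySet Γ (j + 1)) ∨ q⁻¹ * y.2 ∈ polySet Γ (j + 1)} := by
          refine ih hj1 ?_ ?_ ?_ ?_ (by omega)
          · rintro y ⟨p₀, hy, -⟩
            exact hS (y.1, p₀) hy
          · rintro y ⟨p₀, hy, hyp, -⟩ p' hp' m h
            exact hsep _ hy p' (polySet_congr_trans hΓ hj (hmono hp') hyp) m
              (polySet_congr_trans hΓ hj (hmono h) hyp)
          · rintro ⟨S, p⟩ ⟨p₀, hy, hyp, R, hR, hcov⟩ p' hp'S hp' m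
            have hp'0 : p'⁻¹ * p₀ ∈ polySet Γ j := polySet_congr_trans hΓ hj (hmono hp') hyp
            refine ⟨p₀, hstable _ hy p' hp'S hp'0 m, hyp, R, hR, ?_⟩
            rintro q (rfl | hq | ⟨q, hq, rfl⟩) h
            · exact absurd h (hsep _ hy p' hp'0 m)
            · exact hcov q hq.1 h
            · have hq0 : q ∈ polySet Γ 0 := hS _ hy hq.1
              have hqp' : q⁻¹ * p' ∈ polySet Γ j :=
                congr_of_redSeq_congr hΓ hj (hS _ hy hp'S) hq0
                  (polySet_congr_trans hΓ hj h (polySet_congr_symm hΓ hj hp'0))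
              have hqr := polySet_congr_symm hΓ hj1 (redSeq_congr hΓ hj hq0 hqp' m)
              rcases hcov q hq.1 (polySet_congr_trans hΓ hj hqp' hp'0) with ⟨r, hr, hr'⟩ | h'
              · exact Or.inl ⟨r, hr, polySet_congr_trans hΓ hj1 hqr hr'⟩
              · exact Or.inr (polySet_congr_trans hΓ hj1 hqr h')
          · intro s
            obtain ⟨d, hd⟩ := iht s
            refine ⟨d, ?_⟩
            rintro ⟨S, p⟩ ⟨⟨p₀, hy, hyp, R, hR, hcov⟩, hav⟩ hs
            exact hd (S, p₀) ⟨hy, R, hR, fun q hq h => (hcov q hq h).resolve_right (hav q hq)⟩ hs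
        intro s
        obtain ⟨d₁, hd₁⟩ := hΨ' s
        obtain ⟨d₂, hd₂⟩ := havoid s
        refine ⟨max d₁ d₂, ?_⟩
        rintro ⟨S, p⟩ ⟨hx, R, hR, hcov⟩ hs
        by_cases hav : ∀ q ∈ S, q⁻¹ * p ∉ polySet Γ j
        · exact (hd₂ (S, p) ⟨hx, hav⟩ hs).mono (le_max_right _ _)
        · push Not at hav
          obtain ⟨q₀, hq₀, hq₀p⟩ := hav
          obtain ⟨r₀, hr₀, hqr₀⟩ := hcov q₀ hq₀ hq₀p
          classical
          refine (hd₁ (S, q₀) ⟨p, hx, hq₀p, R.erase r₀, ?_, fun q hq h => ?_⟩ hs).mono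
            (le_max_left _ _)
          · rw [Finset.card_erase_of_mem hr₀]; omega
          · obtain ⟨r, hr, hqr⟩ := hcov q hq h
            by_cases hrr : r = r₀
            · subst hrr
              exact Or.inr (polySet_congr_trans hΓ hj1 hqr (polySet_congr_symm hΓ hj1 hqr₀))
            · exact Or.inl ⟨r, Finset.mem_erase.2 ⟨hrr, hr⟩, hqr⟩
    intro s
    obtain ⟨d, hd⟩ := main s s
    refine ⟨d, fun x hx hs => hd x ⟨hx, ?_⟩ hs⟩
    have hfin : x.1.Finite := Set.finite_of_encard_le_coe hs
    refine ⟨hfin.toFinset, ?_, fun q hq _ => ⟨q, by simpa using hq, by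
      simpa using one_mem_polySet (j + 1)⟩⟩
    rw [hfin.encard_eq_coe_toFinset_card] at hs
    exact_mod_cast hs

/-- The PET induction: systems of `s` polynomial sequences adapted to a filtration have complexity
bounded in terms of `s` and the filtration. The induction is downward on the least order `k`;
the classes of the system modulo `polySet Γ (k + 1)`, other than the trivial one, are eliminated
one by one. -/
theorem exists_hasComplexity_of_subset_polySet (hΓ : IsCommFiltration Γ L) (k s : ℕ) :
    ∃ d, ∀ S : Set (ℤ → G), S ⊆ polySet Γ k → S.encard ≤ s → HasComplexity d S := by
  induction hl : L - k generalizing k s with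
  | zero =>
    refine ⟨0, fun S hS _ q hq n => ?_⟩
    rw [eq_one_of_mem_polySet hΓ (by omega) (hS hq)]; rfl
  | succ l ih =>
    have hk1 : 1 ≤ k + 1 := by omega
    have main : ∀ t s : ℕ, ∃ d, ∀ S : Set (ℤ → G), S ⊆ polySet Γ k → S.encard ≤ s →
        (∃ R : Finset (ℤ → G), R.card ≤ t ∧ ∀ q ∈ S, q ∉ polySet Γ (k + 1) →
          ∃ r ∈ R, q⁻¹ * r ∈ polySet Γ (k + 1)) → HasComplexity d S := by
      intro t
      induction t with
      | zero =>
        intro s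
        obtain ⟨d, hd⟩ := ih (k + 1) s (by omega)
        refine ⟨d, fun S _ hs ⟨R, hR, hcov⟩ => hd S (fun q hq => ?_) hs⟩
        by_contra h
        obtain ⟨r, hr, -⟩ := hcov q hq h
        simp [Finset.card_eq_zero.1 (Nat.le_zero.1 hR)] at hr
      | succ t iht =>
        have hΨ' : UniformComplexity {y : Set (ℤ → G) × (ℤ → G) | y.1 ⊆ polySet Γ k ∧
            y.2 ∈ polySet Γ k ∧ y.2 ∉ polySet Γ (k + 1) ∧ ∃ R : Finset (ℤ → G), R.card ≤ t ∧
            ∀ q ∈ y.1, q ∉ polySet Γ (k + 1) →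
              (∃ r ∈ R, q⁻¹ * r ∈ polySet Γ (k + 1)) ∨ q⁻¹ * y.2 ∈ polySet Γ (k + 1)} := by
          refine uniformComplexity_of_avoiding hΓ hk1 ?_ ?_ ?_ ?_
          · rintro y ⟨hy, -⟩
            exact hy.trans (polySet_antitone hΓ (Nat.zero_le k))
          · rintro ⟨S, p⟩ ⟨-, hp, hp', -⟩ p' hpp' m h
            have h1 : p' ∈ polySet Γ k := by
              simpa using mul_succ_mem_polySet hΓ hp (polySet_congr_symm hΓ hk1 hpp')
            have := mul_mem_polySet hΓ hk1 (seqDeriv_mem_polySet h1 m) h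
            rw [mul_inv_cancel_left] at this
            exact hp' this
          · rintro ⟨S, p⟩ ⟨hS, hp, hp1, R, hR, hcov⟩ p' hp'S - m
            have hp'k := hS hp'S
            refine ⟨?_, hp, hp1, R, hR, ?_⟩
            · rintro q (rfl | hq | ⟨q, hq, rfl⟩)
              · exact polySet_antitone hΓ (Nat.le_succ k) (seqDeriv_mem_polySet hp'k m)
              · exact hS hq.1
              · exact redSeq_mem_polySet hΓ hp'k (hS hq.1) m
            · rintro q (rfl | hq | ⟨q, hq, rfl⟩) h
              · exact absurd (seqDeriv_mem_polySet hp'k m) h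
              · exact hcov q hq.1 h
              · have hqr := redSeq_congr_of_mem hΓ hp'k (hS hq.1) m
                have hq1 : q ∉ polySet Γ (k + 1) := fun hq1 =>
                  h (by simpa using mul_mem_polySet hΓ hk1 hq1 hqr)
                have hqr' := polySet_congr_symm hΓ hk1 hqr
                rcases hcov q hq.1 hq1 with ⟨r, hr, hr'⟩ | h'
                · exact Or.inl ⟨r, hr, polySet_congr_trans hΓ hk1 hqr' hr'⟩
                · exact Or.inr (polySet_congr_trans hΓ hk1 hqr' h')
          · intro s
            obtain ⟨d, hd⟩ := iht s
            refine ⟨d, ?_⟩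
            rintro ⟨S, p⟩ ⟨⟨hS, -, -, R, hR, hcov⟩, hav⟩ hs
            exact hd S hS hs ⟨R, hR, fun q hq h => (hcov q hq h).resolve_right (hav q hq)⟩
        intro s
        obtain ⟨d₁, hd₁⟩ := hΨ' s
        obtain ⟨d₂, hd₂⟩ := ih (k + 1) s (by omega)
        refine ⟨max d₁ d₂, ?_⟩
        rintro S hS hs ⟨R, hR, hcov⟩
        by_cases hav : S ⊆ polySet Γ (k + 1)
        · exact (hd₂ S hav hs).mono (le_max_right _ _)
        · obtain ⟨q₀, hq₀, hq₀k⟩ := Set.not_subset.1 hav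
          obtain ⟨r₀, hr₀, hqr₀⟩ := hcov q₀ hq₀ hq₀k
          classical
          refine (hd₁ (S, q₀) ⟨hS, hS hq₀, hq₀k, R.erase r₀, ?_, fun q hq h => ?_⟩ hs).mono
            (le_max_left _ _)
          · rw [Finset.card_erase_of_mem hr₀]; omega
          · obtain ⟨r, hr, hqr⟩ := hcov q hq h
            by_cases hrr : r = r₀
            · subst hrr
              exact Or.inr (polySet_congr_trans hΓ hk1 hqr (polySet_congr_symm hΓ hk1 hqr₀))
            · exact Or.inl ⟨r, Finset.mem_erase.2 ⟨hrr, hr⟩, hqr⟩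
    obtain ⟨d, hd⟩ := main s s
    refine ⟨d, fun S hS hs => hd S hS hs ?_⟩
    have hfin : S.Finite := Set.finite_of_encard_le_coe hs
    refine ⟨hfin.toFinset, ?_, fun q hq _ => ⟨q, by simpa using hq, by
      simpa using one_mem_polySet (k + 1)⟩⟩
    rw [hfin.encard_eq_coe_toFinset_card] at hs
    exact_mod_cast hs

end Complexity

/-! ### Bounded functions, energies and Cesàro averages -/

/-- `f` is measurable and bounded by `C` everywhere. -/
def MeasBdd {𝕜 X : Type*} [RCLike 𝕜] [MeasurableSpace X] (f : X → 𝕜) (C : ℝ) : Prop :=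
  Measurable f ∧ ∀ x, ‖f x‖ ≤ C

/-- The squared `L²` norm. -/
noncomputable def energy {𝕜 X : Type*} [RCLike 𝕜] [MeasurableSpace X] (μ : Measure X)
    (f : X → 𝕜) : ℝ :=
  ∫ x, ‖f x‖ ^ 2 ∂μ

/-- The average of `h 1, …, h N`; it is `0` for `N = 0`. -/
noncomputable def cesaro {𝕜 X : Type*} [RCLike 𝕜] (h : ℕ → X → 𝕜) (N : ℕ) : X → 𝕜 :=
  fun x => (N : 𝕜)⁻¹ * ∑ n ∈ Finset.range N, h (n + 1) x

section Energy

variable {𝕜 X : Type*} [RCLike 𝕜] [MeasurableSpace X]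

theorem MeasBdd.mono {f : X → 𝕜} {C D : ℝ} (hf : MeasBdd f C) (h : C ≤ D) : MeasBdd f D :=
  ⟨hf.1, fun x => (hf.2 x).trans h⟩

theorem MeasBdd.add {f g : X → 𝕜} {C D : ℝ} (hf : MeasBdd f C) (hg : MeasBdd g D) :
    MeasBdd (f + g) (C + D) :=
  ⟨hf.1.add hg.1, fun x => (norm_add_le _ _).trans (add_le_add (hf.2 x) (hg.2 x))⟩

theorem MeasBdd.sub {f g : X → 𝕜} {C D : ℝ} (hf : MeasBdd f C) (hg : MeasBdd g D) :
    MeasBdd (f - g) (C + D) :=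
  ⟨hf.1.sub hg.1, fun x => (norm_sub_le _ _).trans (add_le_add (hf.2 x) (hg.2 x))⟩

theorem MeasBdd.mul {f g : X → 𝕜} {C D : ℝ} (hC : 0 ≤ C) (hf : MeasBdd f C) (hg : MeasBdd g D) :
    MeasBdd (fun x => f x * g x) (C * D) :=
  ⟨hf.1.mul hg.1, fun x => by
    rw [norm_mul]; exact mul_le_mul (hf.2 x) (hg.2 x) (norm_nonneg _) hC⟩

theorem MeasBdd.conj {f : X → 𝕜} {C : ℝ} (hf : MeasBdd f C) :
    MeasBdd (fun x => starRingEnd 𝕜 (f x)) C :=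
  ⟨RCLike.continuous_conj.measurable.comp hf.1, fun x => by rw [RCLike.norm_conj]; exact hf.2 x⟩

theorem MeasBdd.const_mul {f : X → 𝕜} {C : ℝ} (c : 𝕜) (hf : MeasBdd f C) :
    MeasBdd (fun x => c * f x) (‖c‖ * C) :=
  ⟨hf.1.const_mul c, fun x => by
    rw [norm_mul]; exact mul_le_mul_of_nonneg_left (hf.2 x) (norm_nonneg _)⟩

theorem MeasBdd.comp_smul {G : Type*} [Group G] [MulAction G X] [MeasurableConstSMul G X]
    {f : X → 𝕜} {C : ℝ} (hf : MeasBdd f C) (g : G) : MeasBdd (fun x => f (g • x)) C :=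
  ⟨hf.1.comp (measurable_const_smul g), fun _ => hf.2 _⟩

theorem MeasBdd.multiset_prod {ι : Type*} (L : Multiset ι) (f : ι → X → 𝕜)
    (hf : ∀ z ∈ L, MeasBdd (f z) 1) : MeasBdd (fun x => (L.map fun z => f z x).prod) 1 := by
  induction L using Multiset.induction with
  | empty => exact ⟨by simp, by simp⟩
  | cons a L ih =>
    simp only [Multiset.map_cons, Multiset.prod_cons]
    simpa using (hf a (Multiset.mem_cons_self a L)).mul zero_le_one
      (ih fun z hz => hf z (Multiset.mem_cons_of_mem hz))

theorem MeasBdd.cesaro {h : ℕ → X → 𝕜} {C : ℝ} (hC : 0 ≤ C) (hh : ∀ n, MeasBdd (h n) C) (N : ℕ) :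
    MeasBdd (cesaro h N) C := by
  refine ⟨(Finset.measurable_fun_sum _ fun n _ => (hh (n + 1)).1).const_mul _, fun x => ?_⟩
  rcases Nat.eq_zero_or_pos N with rfl | hN
  · simpa [_root_.cesaro] using hC
  have hN' : (0 : ℝ) < N := by exact_mod_cast hN
  calc ‖_root_.cesaro h N x‖ ≤ (N : ℝ)⁻¹ * ∑ n ∈ Finset.range N, ‖h (n + 1) x‖ := by
        rw [_root_.cesaro, norm_mul, norm_inv, RCLike.norm_natCast]
        gcongr; exact norm_sum_le _ _
    _ ≤ (N : ℝ)⁻¹ * ∑ n ∈ Finset.range N, C := by gcongr; exact (hh _).2 x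
    _ = C := by simp [hN'.ne']

variable {μ : Measure X}

theorem MeasBdd.integrable [IsFiniteMeasure μ] {f : X → 𝕜} {C : ℝ} (hf : MeasBdd f C) :
    Integrable f μ :=
  Integrable.of_bound hf.1.aestronglyMeasurable C (ae_of_all _ hf.2)

theorem MeasBdd.integrable_norm_sq [IsFiniteMeasure μ] {f : X → 𝕜} {C : ℝ}
    (hf : MeasBdd f C) :
    Integrable (fun x => ‖f x‖ ^ 2) μ :=
  Integrable.of_bound (hf.1.norm.pow_const 2).aestronglyMeasurable (C ^ 2) (ae_of_all _ fun x => by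
    rw [Real.norm_of_nonneg (by positivity)]
    exact pow_le_pow_left₀ (norm_nonneg _) (hf.2 x) 2)

theorem energy_nonneg (f : X → 𝕜) : 0 ≤ energy μ f :=
  integral_nonneg fun _ => by positivity

theorem energy_le_of_measBdd [IsProbabilityMeasure μ] {f : X → 𝕜} {C : ℝ} (hf : MeasBdd f C) :
    energy μ f ≤ C ^ 2 := by
  calc energy μ f ≤ ∫ _, C ^ 2 ∂μ := integral_mono hf.integrable_norm_sq (integrable_const _)
        fun x => pow_le_pow_left₀ (norm_nonneg _) (hf.2 x) 2
    _ = C ^ 2 := by simp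

theorem energy_add_le [IsFiniteMeasure μ] {f g : X → 𝕜} {C D : ℝ} (hf : MeasBdd f C)
    (hg : MeasBdd g D) :
    energy μ (f + g) ≤ 2 * energy μ f + 2 * energy μ g := by
  unfold energy
  rw [← integral_const_mul, ← integral_const_mul, ← integral_add
    (hf.integrable_norm_sq.const_mul 2) (hg.integrable_norm_sq.const_mul 2)]
  refine integral_mono (hf.add hg).integrable_norm_sq
    ((hf.integrable_norm_sq.const_mul 2).add (hg.integrable_norm_sq.const_mul 2)) fun x => ?_
  have h1 : ‖(f + g) x‖ ≤ ‖f x‖ + ‖g x‖ := norm_add_le _ _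
  have h2 := pow_le_pow_left₀ (norm_nonneg _) h1 2
  simp only
  nlinarith [sq_nonneg (‖f x‖ - ‖g x‖)]

theorem energy_const_mul (c : 𝕜) (f : X → 𝕜) :
    energy μ (fun x => c * f x) = ‖c‖ ^ 2 * energy μ f := by
  simp only [energy, norm_mul, mul_pow, integral_const_mul]

theorem energy_neg (f : X → 𝕜) : energy μ (-f) = energy μ f := by
  simp [energy]

theorem energy_sub_le [IsFiniteMeasure μ] {f g : X → 𝕜} {C D : ℝ} (hf : MeasBdd f C)
    (hg : MeasBdd g D) :
    energy μ (f - g) ≤ 2 * energy μ f + 2 * energy μ g := by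
  rw [sub_eq_add_neg, ← energy_neg g]
  exact energy_add_le hf ⟨hg.1.neg, fun x => by simpa using hg.2 x⟩

theorem energy_comp_smul {G : Type*} [Group G] [MulAction G X] [MeasurableConstSMul G X]
    [SMulInvariantMeasure G X μ] (f : X → 𝕜) (g : G) :
    energy μ (fun x => f (g • x)) = energy μ f :=
  integral_smul_eq_self (fun x => ‖f x‖ ^ 2)

/-- Convexity of the energy. -/
theorem energy_cesaro_le [IsFiniteMeasure μ] {h : ℕ → X → 𝕜} {C : ℝ} (hC : 0 ≤ C)
    (hh : ∀ n, MeasBdd (h n) C) (N : ℕ) :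
    energy μ (cesaro h N) ≤ (N : ℝ)⁻¹ * ∑ n ∈ Finset.range N, energy μ (h (n + 1)) := by
  unfold energy
  rw [← integral_finsetSum _ fun n _ => (hh (n + 1)).integrable_norm_sq, ← integral_const_mul]
  refine integral_mono (MeasBdd.cesaro hC hh N).integrable_norm_sq
    ((integrable_finsetSum _ fun n _ => (hh (n + 1)).integrable_norm_sq).const_mul _) fun x => ?_
  rcases Nat.eq_zero_or_pos N with rfl | hN
  · simp [cesaro]
  have hN' : (0 : ℝ) < N := by exact_mod_cast hN
  simp only [cesaro, norm_mul, norm_inv, RCLike.norm_natCast, mul_pow]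
  have h1 := pow_le_pow_left₀ (norm_nonneg _)
    (norm_sum_le (Finset.range N) fun n => h (n + 1) x) 2
  have h2 := sq_sum_le_card_mul_sum_sq (s := Finset.range N) (f := fun n => ‖h (n + 1) x‖)
  rw [Finset.card_range] at h2
  calc (N : ℝ)⁻¹ ^ 2 * ‖∑ n ∈ Finset.range N, h (n + 1) x‖ ^ 2
      ≤ (N : ℝ)⁻¹ ^ 2 * (N * ∑ n ∈ Finset.range N, ‖h (n + 1) x‖ ^ 2) := by
        gcongr; exact h1.trans h2
    _ = (N : ℝ)⁻¹ * ∑ n ∈ Finset.range N, ‖h (n + 1) x‖ ^ 2 := by field_simp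

theorem energy_sub_eq [IsFiniteMeasure μ] {f g : X → 𝕜} {C D : ℝ} (hf : MeasBdd f C)
    (hg : MeasBdd g D) :
    energy μ (f - g) =
      energy μ f - 2 * RCLike.re (∫ x, starRingEnd 𝕜 (g x) * f x ∂μ) + energy μ g := by
  have hfg : Integrable (fun x => starRingEnd 𝕜 (g x) * f x) μ :=
    (MeasBdd.mul ((abs_nonneg D)) (hg.conj.mono (le_abs_self D)) hf).integrable
  have hre : Integrable (fun x => 2 * RCLike.re (starRingEnd 𝕜 (g x) * f x)) μ :=
    hfg.re.const_mul 2
  have hsub : Integrable (fun x => ‖f x‖ ^ 2 - 2 * RCLike.re (starRingEnd 𝕜 (g x) * f x)) μ :=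
    hf.integrable_norm_sq.sub hre
  unfold energy
  rw [← integral_re hfg, ← integral_const_mul, ← integral_sub hf.integrable_norm_sq hre,
    ← integral_add hsub hg.integrable_norm_sq]
  refine integral_congr_ae (ae_of_all _ fun x => ?_)
  have := norm_sub_sq (𝕜 := 𝕜) (g x) (f x)
  simp only [Pi.sub_apply, RCLike.inner_apply'] at this ⊢
  rw [norm_sub_rev, this]; ring

end Energy

/-! ### Multiple averages and dual functions -/

/-- The product `x ↦ ∏ f (q n • x)` over a system `L` of pairs `(q, f)`. -/
def sysProd {𝕜 G X : Type*} [RCLike 𝕜] [Group G] [MulAction G X]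
    (L : Multiset ((ℤ → G) × (X → 𝕜))) (n : ℤ) : X → 𝕜 :=
  fun x => (L.map fun z => z.2 (z.1 n • x)).prod

/-- The multiple averages of a system of pairs (sequence, function). -/
noncomputable def sysAvg {𝕜 G X : Type*} [RCLike 𝕜] [Group G] [MulAction G X]
    (L : Multiset ((ℤ → G) × (X → 𝕜))) (N : ℕ) : X → 𝕜 :=
  cesaro (fun n => sysProd L n) N

/-- The multiple averages of the system obtained from `L` by adding the pair `(p, f)`. -/
noncomputable def pivotAvg {𝕜 G X : Type*} [RCLike 𝕜] [Group G] [MulAction G X]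
    (p : ℤ → G) (L : Multiset ((ℤ → G) × (X → 𝕜))) (f : X → 𝕜) (N : ℕ) : X → 𝕜 :=
  cesaro (fun n x => f (p n • x) * sysProd L n x) N

/-- The dual function: the value at `u` of the adjoint of the linear operator
`f ↦ pivotAvg p L f N`. -/
noncomputable def dualFn {𝕜 G X : Type*} [RCLike 𝕜] [Group G] [MulAction G X]
    (p : ℤ → G) (L : Multiset ((ℤ → G) × (X → 𝕜))) (u : X → 𝕜) (N : ℕ) : X → 𝕜 :=
  cesaro (fun n x => u ((p n)⁻¹ • x) * starRingEnd 𝕜 (sysProd L n ((p n)⁻¹ • x))) N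

/-- The reduction of the system `L` at a pivot `p` not in `L`, with the function `v` attached to the
derivative of `p`. -/
def redSys {𝕜 G X : Type*} [RCLike 𝕜] [Group G]
    (p : ℤ → G) (m : ℤ) (v : X → 𝕜) (L : Multiset ((ℤ → G) × (X → 𝕜))) :
    Multiset ((ℤ → G) × (X → 𝕜)) :=
  (seqDeriv m p, v) ::ₘ (L + L.map fun z => (redSeq p m z.1, fun x => starRingEnd 𝕜 (z.2 x)))

theorem measBdd_redSys {𝕜 G X : Type*} [RCLike 𝕜] [Group G] [MeasurableSpace X]
    {p : ℤ → G} {m : ℤ} {v : X → 𝕜} {L : Multiset ((ℤ → G) × (X → 𝕜))}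
    (hL : ∀ z ∈ L, MeasBdd z.2 1) (hv : MeasBdd v 1) : ∀ z ∈ redSys p m v L, MeasBdd z.2 1 := by
  intro z hz
  rcases Multiset.mem_cons.1 hz with rfl | hz
  · exact hv
  rcases Multiset.mem_add.1 hz with hz | hz
  · exact hL z hz
  · obtain ⟨y, hy, rfl⟩ := Multiset.mem_map.1 hz
    exact (hL y hy).conj

section Dual

variable {𝕜 G X : Type*} [RCLike 𝕜] [Group G] [MulAction G X]

theorem sysProd_redSys (p : ℤ → G) (m : ℤ) (v : X → 𝕜) (L : Multiset ((ℤ → G) × (X → 𝕜)))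
    (n : ℤ) (x : X) :
    sysProd (redSys p m v L) n x = v ((p (n + m))⁻¹ • p n • x) *
      starRingEnd 𝕜 (sysProd L (n + m) ((p (n + m))⁻¹ • p n • x)) * sysProd L n x := by
  simp only [sysProd, redSys, Multiset.map_cons, Multiset.prod_cons, Multiset.map_add,
    Multiset.prod_add, Multiset.map_map, Function.comp_def, map_multiset_prod, redSeq, seqDeriv,
    mul_smul]
  ring

theorem pivotAvg_add (p : ℤ → G) (L : Multiset ((ℤ → G) × (X → 𝕜))) (f g : X → 𝕜) (N : ℕ) :
    pivotAvg p L (f + g) N = pivotAvg p L f N + pivotAvg p L g N := by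
  funext x
  simp only [pivotAvg, cesaro, Pi.add_apply, add_mul, Finset.sum_add_distrib, mul_add]

theorem pivotAvg_zero (p : ℤ → G) (L : Multiset ((ℤ → G) × (X → 𝕜))) (N : ℕ) :
    pivotAvg p L 0 N = 0 := by
  funext x
  simp [pivotAvg, cesaro]

/-- Shifting the range of summation of a Cesàro average by `n` changes it by `O(n / N)`. -/
theorem norm_cesaro_sub_shift_le (h : ℕ → 𝕜) {C : ℝ} (hh : ∀ n, ‖h n‖ ≤ C) (N n : ℕ) :
    ‖(N : 𝕜)⁻¹ * ∑ m ∈ Finset.range N, h (m + 1) -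
      (N : 𝕜)⁻¹ * ∑ m ∈ Finset.range N, h (n + (m + 1))‖ ≤ 2 * n * C / N := by
  have hC : 0 ≤ C := (norm_nonneg _).trans (hh 0)
  have key : ‖∑ m ∈ Finset.range N, h (m + 1) - ∑ m ∈ Finset.range N, h (n + (m + 1))‖ ≤
      2 * n * C := by
    induction n with
    | zero => simp
    | succ n ih =>
      have h1 : ∑ m ∈ Finset.range N, h (n + 1 + (m + 1)) + h (n + 1) =
          ∑ m ∈ Finset.range N, h (n + (m + 1)) + h (n + (N + 1)) := by
        rw [← Finset.sum_range_succ (fun m => h (n + (m + 1))), Finset.sum_range_succ']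
        simp only [zero_add, add_comm, add_left_comm]
      have h2 : ∑ m ∈ Finset.range N, h (m + 1) - ∑ m ∈ Finset.range N, h (n + 1 + (m + 1)) =
          (∑ m ∈ Finset.range N, h (m + 1) - ∑ m ∈ Finset.range N, h (n + (m + 1))) +
            (h (n + 1) - h (n + (N + 1))) := by
        linear_combination -h1
      rw [h2]
      have h3 := norm_add_le
        (∑ m ∈ Finset.range N, h (m + 1) - ∑ m ∈ Finset.range N, h (n + (m + 1)))
        (h (n + 1) - h (n + (N + 1)))
      have h4 := norm_sub_le (h (n + 1)) (h (n + (N + 1)))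
      have h5 := hh (n + 1)
      have h6 := hh (n + (N + 1))
      push_cast
      linarith
  rw [← mul_sub, norm_mul, norm_inv, RCLike.norm_natCast, div_eq_inv_mul]
  gcongr

variable [MeasurableSpace X] [MeasurableConstSMul G X]

theorem measBdd_sysProd {L : Multiset ((ℤ → G) × (X → 𝕜))} (hL : ∀ z ∈ L, MeasBdd z.2 1) (n : ℤ) :
    MeasBdd (sysProd L n) 1 :=
  MeasBdd.multiset_prod L (fun z x => z.2 (z.1 n • x)) fun z hz => (hL z hz).comp_smul _

theorem measBdd_sysAvg {L : Multiset ((ℤ → G) × (X → 𝕜))} (hL : ∀ z ∈ L, MeasBdd z.2 1) (N : ℕ) :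
    MeasBdd (sysAvg L N) 1 :=
  MeasBdd.cesaro zero_le_one (fun n => measBdd_sysProd hL n) N

theorem measBdd_pivotAvg {p : ℤ → G} {L : Multiset ((ℤ → G) × (X → 𝕜))}
    (hL : ∀ z ∈ L, MeasBdd z.2 1) {f : X → 𝕜} {C : ℝ} (hC : 0 ≤ C) (hf : MeasBdd f C) (N : ℕ) :
    MeasBdd (pivotAvg p L f N) C :=
  MeasBdd.cesaro hC (fun n => by
    simpa using (hf.comp_smul (p n)).mul hC (measBdd_sysProd hL n)) N

theorem measBdd_dual_term {p : ℤ → G} {L : Multiset ((ℤ → G) × (X → 𝕜))}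
    (hL : ∀ z ∈ L, MeasBdd z.2 1) {u : X → 𝕜} {C : ℝ} (hC : 0 ≤ C) (hu : MeasBdd u C) (n : ℤ) :
    MeasBdd (fun x => u ((p n)⁻¹ • x) * starRingEnd 𝕜 (sysProd L n ((p n)⁻¹ • x))) C := by
  simpa using (hu.comp_smul (p n)⁻¹).mul hC ((measBdd_sysProd hL n).comp_smul (p n)⁻¹).conj

theorem measBdd_dualFn {p : ℤ → G} {L : Multiset ((ℤ → G) × (X → 𝕜))}
    (hL : ∀ z ∈ L, MeasBdd z.2 1) {u : X → 𝕜} {C : ℝ} (hC : 0 ≤ C) (hu : MeasBdd u C) (N : ℕ) :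
    MeasBdd (dualFn p L u N) C :=
  MeasBdd.cesaro hC (fun n => measBdd_dual_term hL hC hu n) N

variable {μ : Measure X} [SMulInvariantMeasure G X μ]

/-- The energy decrement: subtracting from `f` the dual function of its own average `u` lowers the
energy of `f` by at least the energy of `u`. Indeed the dual function has inner product
`energy μ u` with `f`, and energy at most `energy μ u`. -/
theorem energy_sub_dualFn_le [IsFiniteMeasure μ] {p : ℤ → G}
    {L : Multiset ((ℤ → G) × (X → 𝕜))} (hL : ∀ z ∈ L, MeasBdd z.2 1) {f : X → 𝕜} {C : ℝ}
    (hC : 0 ≤ C) (hf : MeasBdd f C) {N : ℕ} (hN : 0 < N) :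
    energy μ (f - dualFn p L (pivotAvg p L f N) N) ≤ energy μ f - energy μ (pivotAvg p L f N) := by
  set u := pivotAvg p L f N with hu_def
  have hu : MeasBdd u C := measBdd_pivotAvg hL hC hf N
  have hN' : (0 : ℝ) < N := by exact_mod_cast hN
  have hσ : energy μ (dualFn p L u N) ≤ energy μ u := by
    refine (energy_cesaro_le hC (fun n => measBdd_dual_term hL hC hu n) N).trans ?_
    have hterm : ∀ n : ℕ, energy μ (fun x => u ((p n)⁻¹ • x) *
        starRingEnd 𝕜 (sysProd L n ((p n)⁻¹ • x))) ≤ energy μ u := fun n => by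
      rw [← energy_comp_smul (μ := μ) u (p n)⁻¹]
      refine integral_mono (measBdd_dual_term hL hC hu n).integrable_norm_sq
        (hu.comp_smul _).integrable_norm_sq fun x => ?_
      refine pow_le_pow_left₀ (norm_nonneg _) ?_ 2
      rw [norm_mul, RCLike.norm_conj]
      exact mul_le_of_le_one_right (norm_nonneg _) ((measBdd_sysProd hL n).2 _)
    calc (N : ℝ)⁻¹ * ∑ n ∈ Finset.range N, _ ≤ (N : ℝ)⁻¹ * ∑ n ∈ Finset.range N, energy μ u := by
          gcongr with n; exact hterm (n + 1)
      _ = energy μ u := by simp [hN'.ne']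
  have hinner : ∫ x, starRingEnd 𝕜 (dualFn p L u N x) * f x ∂μ = (energy μ u : 𝕜) := by
    have hint1 : ∀ n : ℕ, Integrable (fun x => starRingEnd 𝕜 (u ((p n)⁻¹ • x) *
        starRingEnd 𝕜 (sysProd L n ((p n)⁻¹ • x))) * f x) μ := fun n =>
      ((measBdd_dual_term hL hC hu n).conj.mul hC hf).integrable
    have hint2 : ∀ n : ℕ, Integrable (fun x => starRingEnd 𝕜 (u x) *
        (f (p n • x) * sysProd L n x)) μ := fun n =>
      (hu.conj.mul hC ((hf.comp_smul (p n)).mul hC (measBdd_sysProd hL n))).integrable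
    have hterm : ∀ n : ℕ, ∫ x, starRingEnd 𝕜 (u ((p n)⁻¹ • x) *
        starRingEnd 𝕜 (sysProd L n ((p n)⁻¹ • x))) * f x ∂μ =
        ∫ x, starRingEnd 𝕜 (u x) * (f (p n • x) * sysProd L n x) ∂μ := fun n => by
      rw [← integral_smul_eq_self (fun x => starRingEnd 𝕜 (u x) * (f (p n • x) * sysProd L n x))
        (g := (p n)⁻¹)]
      refine integral_congr_ae (ae_of_all _ fun x => ?_)
      simp only [smul_inv_smul, map_mul, RCLike.conj_conj]
      ring
    calc ∫ x, starRingEnd 𝕜 (dualFn p L u N x) * f x ∂μ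
        = ∫ x, (N : 𝕜)⁻¹ * ∑ n ∈ Finset.range N, (starRingEnd 𝕜 (u ((p (n + 1 : ℕ))⁻¹ • x) *
            starRingEnd 𝕜 (sysProd L (n + 1 : ℕ) ((p (n + 1 : ℕ))⁻¹ • x))) * f x) ∂μ := by
          refine integral_congr_ae (ae_of_all _ fun x => ?_)
          simp only [dualFn, cesaro, map_mul, map_inv₀, map_natCast, map_sum, Finset.sum_mul,
            mul_assoc]
      _ = ∫ x, (N : 𝕜)⁻¹ * ∑ n ∈ Finset.range N, (starRingEnd 𝕜 (u x) *
            (f (p (n + 1 : ℕ) • x) * sysProd L (n + 1 : ℕ) x)) ∂μ := by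
          rw [integral_const_mul, integral_const_mul,
            integral_finsetSum _ fun n _ => hint1 (n + 1),
            integral_finsetSum _ fun n _ => hint2 (n + 1)]
          simp only [hterm]
      _ = ∫ x, ((‖u x‖ ^ 2 : ℝ) : 𝕜) ∂μ := by
          refine integral_congr_ae (ae_of_all _ fun x => ?_)
          simp only [← Finset.mul_sum]
          rw [mul_left_comm, RCLike.ofReal_pow, ← RCLike.conj_mul]
          rfl
      _ = (energy μ u : 𝕜) := integral_ofReal
  rw [energy_sub_eq hf (measBdd_dualFn hL hC hu N), hinner, RCLike.ofReal_re]
  linarith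

/-- The averages of a dual function are, on a time scale `l` much shorter than `N`, close to an
average of multiple averages of reduced systems. -/
theorem norm_pivotAvg_dualFn_sub_le {p : ℤ → G}
    {L : Multiset ((ℤ → G) × (X → 𝕜))} (hL : ∀ z ∈ L, MeasBdd z.2 1) {u : X → 𝕜} {C : ℝ}
    (hC : 0 < C) (hu : MeasBdd u C) (N l : ℕ) (x : X) :
    ‖pivotAvg p L (dualFn p L u N) l x -
      C * cesaro (fun m => sysAvg (redSys p m (fun y => (C : 𝕜)⁻¹ * u y) L) l) N x‖ ≤
      2 * l * C / N := by
  have hC' : (C : 𝕜) ≠ 0 := by exact_mod_cast hC.ne'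
  set κ : ℕ → X → 𝕜 := fun m y =>
    u ((p m)⁻¹ • y) * starRingEnd 𝕜 (sysProd L m ((p m)⁻¹ • y)) with hκ
  have hκb : ∀ m y, ‖κ m y‖ ≤ C := fun m y => (measBdd_dual_term hL hC.le hu m).2 y
  have h1 : C * cesaro (fun m => sysAvg (redSys p m (fun y => (C : 𝕜)⁻¹ * u y) L) l) N x =
      (l : 𝕜)⁻¹ * ∑ n ∈ Finset.range l, ((N : 𝕜)⁻¹ *
        ∑ m ∈ Finset.range N, κ ((n + 1) + (m + 1)) (p (n + 1 : ℕ) • x)) *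
          sysProd L (n + 1 : ℕ) x := by
    simp only [cesaro, sysAvg, sysProd_redSys, hκ, Finset.mul_sum, Finset.sum_mul]
    rw [Finset.sum_comm]
    refine Finset.sum_congr rfl fun n _ => Finset.sum_congr rfl fun m _ => ?_
    push_cast
    field_simp
  have h2 : pivotAvg p L (dualFn p L u N) l x =
      (l : 𝕜)⁻¹ * ∑ n ∈ Finset.range l, ((N : 𝕜)⁻¹ *
        ∑ m ∈ Finset.range N, κ (m + 1) (p (n + 1 : ℕ) • x)) * sysProd L (n + 1 : ℕ) x := rfl
  rw [h1, h2, ← mul_sub, ← Finset.sum_sub_distrib, norm_mul, norm_inv, RCLike.norm_natCast]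
  rcases Nat.eq_zero_or_pos l with rfl | hl
  · simp
  have hl' : (0 : ℝ) < l := by exact_mod_cast hl
  calc (l : ℝ)⁻¹ * ‖∑ n ∈ Finset.range l, _‖
      ≤ (l : ℝ)⁻¹ * ∑ n ∈ Finset.range l, 2 * l * C / N := by
        gcongr
        refine norm_sum_le_of_le _ fun n hn => ?_
        rw [← sub_mul, norm_mul]
        refine (mul_le_of_le_one_right (norm_nonneg _) ((measBdd_sysProd hL _).2 _)).trans ?_
        refine (norm_cesaro_sub_shift_le (fun m => κ m (p (n + 1 : ℕ) • x))
          (fun m => hκb m _) N (n + 1)).trans ?_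
        have : ((n + 1 : ℕ) : ℝ) ≤ l := by exact_mod_cast Finset.mem_range.1 hn
        gcongr
    _ = 2 * l * C / N := by simp [hl'.ne']

end Dual

/-! ### Uniform metastability -/

/-- The system `L` has functions bounded by `1` and sequences of complexity at most `d`. -/
def IsAdmissible {𝕜 G X : Type*} [RCLike 𝕜] [Group G] [MeasurableSpace X] (d : ℕ)
    (L : Multiset ((ℤ → G) × (X → 𝕜))) : Prop :=
  (∀ z ∈ L, MeasBdd z.2 1) ∧ HasComplexity d {q | ∃ z ∈ L, z.1 = q}

/-- Uniform metastability at complexity `d`: for every `F : ℕ → ℕ`, every finite weighted family of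
admissible systems has averages that are stable, in weighted mean square, on a common interval
`[M, F M]`, whose location is bounded in terms of `F`, the precision and the total weight only.
Families of systems are needed because the reductions of a single system at all steps `m` have to
be controlled at once. -/
def UniformlyMetastable (𝕜 G : Type*) {X : Type*} [RCLike 𝕜] [Group G] [MeasurableSpace X]
    [MulAction G X] (μ : Measure X) (d : ℕ) : Prop :=
  ∀ (W ε : ℝ), 0 < ε → ∀ (F : ℕ → ℕ) (a : ℕ), ∃ b : ℕ,
    ∀ (ι : Type) [Fintype ι] (w : ι → ℝ) (L : ι → Multiset ((ℤ → G) × (X → 𝕜))),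
      (∀ i, 0 ≤ w i) → ∑ i, w i ≤ W → (∀ i, IsAdmissible d (L i)) →
      ∃ M, a ≤ M ∧ F M ≤ b ∧ ∀ N ∈ Set.Icc M (F M), ∀ N' ∈ Set.Icc M (F M),
        ∑ i, w i * energy μ (sysAvg (L i) N - sysAvg (L i) N') ≤ ε

section Metastable

variable {𝕜 G X : Type*} [RCLike 𝕜] [Group G] [MeasurableSpace X] [MulAction G X]

theorem uniformlyMetastable_zero (μ : Measure X) : UniformlyMetastable 𝕜 G μ 0 := by
  intro W ε hε F a
  refine ⟨F (max a 1), fun ι _ w L _ _ hL => ⟨max a 1, le_max_left _ _, le_rfl, ?_⟩⟩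
  have key : ∀ i, ∀ N ∈ Set.Icc (max a 1) (F (max a 1)), sysAvg (L i) N = sysProd (L i) 0 := by
    intro i N hN
    have hN0 : (N : 𝕜) ≠ 0 := by
      have := (le_max_right a 1).trans hN.1
      exact_mod_cast (by omega : N ≠ 0)
    have hconst : ∀ n, sysProd (L i) n = sysProd (L i) 0 := fun n => by
      funext x
      simp only [sysProd]
      congr 1
      exact Multiset.map_congr rfl fun z hz => by rw [(hL i).2 z.1 ⟨z, hz, rfl⟩ n]
    funext x
    simp only [sysAvg, cesaro, hconst, Finset.sum_const, Finset.card_range, nsmul_eq_mul]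
    field_simp
  intro N hN N' hN'
  simp only [key _ N hN, key _ N' hN', sub_self]
  simpa [energy] using hε.le

variable [MeasurableConstSMul G X] {μ : Measure X} [IsProbabilityMeasure μ]

/-- The variation of the averages of a dual function on a time scale shorter than `b` is controlled
by that of the averages of the reduced systems. -/
theorem energy_pivotAvg_dualFn_sub_le {p : ℤ → G}
    {L : Multiset ((ℤ → G) × (X → 𝕜))} (hL : ∀ z ∈ L, MeasBdd z.2 1) {u : X → 𝕜} {C : ℝ}
    (hC : 0 < C) (hu : MeasBdd u C) {N l l' b : ℕ} (hl : l ≤ b) (hl' : l' ≤ b) :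
    energy μ (pivotAvg p L (dualFn p L u N) l - pivotAvg p L (dualFn p L u N) l') ≤
      2 * (4 * b * C / N) ^ 2 + 2 * C ^ 2 * ((N : ℝ)⁻¹ * ∑ m ∈ Finset.range N,
        energy μ (sysAvg (redSys p (m + 1 : ℕ) (fun y => (C : 𝕜)⁻¹ * u y) L) l -
          sysAvg (redSys p (m + 1 : ℕ) (fun y => (C : 𝕜)⁻¹ * u y) L) l')) := by
  set R : ℕ → Multiset ((ℤ → G) × (X → 𝕜)) :=
    fun m => redSys p m (fun y => (C : 𝕜)⁻¹ * u y) L with hR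
  have hv : MeasBdd (fun y => (C : 𝕜)⁻¹ * u y) 1 := by
    have := hu.const_mul (C : 𝕜)⁻¹
    rwa [norm_inv, RCLike.norm_ofReal, abs_of_pos hC, inv_mul_cancel₀ hC.ne'] at this
  have hRb : ∀ m, ∀ z ∈ R m, MeasBdd z.2 1 := fun m => measBdd_redSys hL hv
  set T : ℕ → X → 𝕜 := fun l => cesaro (fun m => sysAvg (R m) l) N with hT
  have hTb : ∀ l, MeasBdd (T l) 1 := fun l =>
    MeasBdd.cesaro zero_le_one (fun m => measBdd_sysAvg (hRb m) l) N
  set P : ℕ → X → 𝕜 := fun l => pivotAvg p L (dualFn p L u N) l with hP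
  have hPb : ∀ l, MeasBdd (P l) C := fun l =>
    measBdd_pivotAvg hL hC.le (measBdd_dualFn hL hC.le hu N) l
  set E : ℕ → X → 𝕜 := fun l x => P l x - C * T l x with hE
  have hEb : ∀ l ≤ b, MeasBdd (E l) (2 * b * C / N) := fun l hl =>
    ⟨(hPb l).1.sub ((hTb l).1.const_mul _), fun x => by
      refine (norm_pivotAvg_dualFn_sub_le hL hC hu N l x).trans ?_
      have : (l : ℝ) ≤ b := by exact_mod_cast hl
      gcongr⟩
  have hTT : MeasBdd (T l - T l') (1 + 1) := (hTb l).sub (hTb l')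
  have hdecomp : P l - P l' = (E l - E l') + fun x => (C : 𝕜) * (T l - T l') x := by
    funext x; simp only [hE, Pi.sub_apply, Pi.add_apply]; ring
  have hE2 : energy μ (E l - E l') ≤ (4 * b * C / N) ^ 2 := by
    refine (energy_le_of_measBdd ((hEb l hl).sub (hEb l' hl'))).trans_eq ?_
    ring
  have hTe : energy μ (T l - T l') ≤ (N : ℝ)⁻¹ * ∑ m ∈ Finset.range N,
      energy μ (sysAvg (R (m + 1)) l - sysAvg (R (m + 1)) l') := by
    have : T l - T l' = cesaro (fun m => sysAvg (R m) l - sysAvg (R m) l') N := by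
      funext x
      simp only [hT, cesaro, Pi.sub_apply, Finset.sum_sub_distrib, mul_sub]
    rw [this]
    exact energy_cesaro_le (by norm_num)
      (fun m => (measBdd_sysAvg (hRb m) l).sub (measBdd_sysAvg (hRb m) l')) N
  calc energy μ (P l - P l') ≤ 2 * energy μ (E l - E l') +
        2 * energy μ (fun x => (C : 𝕜) * (T l - T l') x) := by
        rw [hdecomp]
        exact energy_add_le ((hEb l hl).sub (hEb l' hl')) (hTT.const_mul _)
    _ = 2 * energy μ (E l - E l') + 2 * C ^ 2 * energy μ (T l - T l') := by
        rw [energy_const_mul, RCLike.norm_ofReal, sq_abs, mul_assoc]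
    _ ≤ _ := by gcongr

variable [SMulInvariantMeasure G X μ]

/-- The structure theorem. On a suitable interval `[M, F M]`, the functions `f i` split into a part
`g i` with small averages and a part `h i` with stable averages, while a given family `K` of systems
of lower complexity is stable too. By induction on the energy, counted in units of `η`: as long as
some average `N` of the `f i` on a late window is large, the corresponding dual functions are
subtracted from the `f i` and the reduced systems are added to the family `K`. The next window lies
much before `N`, so that the averages of the dual functions are approximated on it by those of the
reduced systems. -/
theorem exists_structured_decomposition {d : ℕ} (hd : UniformlyMetastable 𝕜 G μ d) (r : ℕ) :
    ∀ (C W V η δ : ℝ), 0 < C → 0 ≤ W → 0 < η → 0 < δ → ∀ (F : ℕ → ℕ) (a : ℕ), ∃ b : ℕ,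
    ∀ (ι : Type) [Fintype ι] (w : ι → ℝ) (p : ι → ℤ → G) (f : ι → X → 𝕜)
      (L : ι → Multiset ((ℤ → G) × (X → 𝕜)))
      (κ : Type) [Fintype κ] (v : κ → ℝ) (K : κ → Multiset ((ℤ → G) × (X → 𝕜))),
      (∀ i, 0 ≤ w i) → ∑ i, w i ≤ W → (∀ i, MeasBdd (f i) C) →
      (∀ i, ∀ z ∈ L i, MeasBdd z.2 1) →
      (∀ i m u, MeasBdd u 1 → IsAdmissible d (redSys (p i) m u (L i))) →
      ∑ i, w i * energy μ (f i) < r * η →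
      (∀ k, 0 ≤ v k) → ∑ k, v k ≤ V → (∀ k, IsAdmissible d (K k)) →
      ∃ M, a ≤ M ∧ F M ≤ b ∧ ∃ (g h : ι → X → 𝕜) (D : ℝ), 0 ≤ D ∧ (∀ i, f i = g i + h i) ∧
        (∀ i, MeasBdd (g i) D) ∧ (∀ i, MeasBdd (h i) D) ∧
        (∀ N ∈ Set.Icc M (F M), ∑ i, w i * energy μ (pivotAvg (p i) (L i) (g i) N) ≤ η) ∧
        (∀ N ∈ Set.Icc M (F M), ∀ N' ∈ Set.Icc M (F M),
          ∑ i, w i * energy μ (pivotAvg (p i) (L i) (h i) N - pivotAvg (p i) (L i) (h i) N') ≤ δ ∧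
          ∑ k, v k * energy μ (sysAvg (K k) N - sysAvg (K k) N') ≤ δ) := by
  induction r with
  | zero =>
    intro C W V η δ _ _ _ _ F a
    refine ⟨0, fun ι _ w p f L κ _ v K hw _ _ _ _ he _ _ _ => ?_⟩
    have : 0 ≤ ∑ i, w i * energy μ (f i) :=
      Finset.sum_nonneg fun i _ => mul_nonneg (hw i) (energy_nonneg _)
    simp only [Nat.cast_zero, zero_mul] at he
    linarith
  | succ r ih =>
    intro C W V η δ hC hW hη hδ F a
    obtain ⟨b₁, hb₁⟩ := ih (C + C) W (V + W) η (δ / (4 + 8 * C ^ 2)) (by positivity) hW hη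
      (by positivity) F a
    -- the window on which averages are tested starts much later than `b₁`
    obtain ⟨A, hA⟩ := exists_nat_ge (128 * W * b₁ ^ 2 * C ^ 2 / δ)
    set a₀ := max a (max A 1) with ha₀
    obtain ⟨b₀, hb₀⟩ := hd V δ hδ F a₀
    refine ⟨max b₀ b₁, fun ι _ w p f L κ _ v K hw hwW hf hL hadm he hv hvV hK => ?_⟩
    by_cases hsmall : ∀ N ∈ Set.Icc a₀ b₀, ∑ i, w i * energy μ (pivotAvg (p i) (L i) (f i) N) ≤ η
    · obtain ⟨M, haM, hFM, hM⟩ := hb₀ κ v K hv hvV hK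
      refine ⟨M, (le_max_left _ _).trans haM, hFM.trans (le_max_left _ _), f, 0, C, hC.le,
        fun i => by simp, hf, fun i => ⟨measurable_const, fun x => by simpa using hC.le⟩,
        fun N hN => hsmall N ⟨haM.trans hN.1, hN.2.trans hFM⟩,
        fun N hN N' hN' => ⟨?_, hM N hN N' hN'⟩⟩
      simpa [pivotAvg_zero, energy] using hδ.le
    · push Not at hsmall
      obtain ⟨N, hN, hlarge⟩ := hsmall
      have hA0 : A ≤ N := ((le_max_left _ _).trans (le_max_right _ _)).trans hN.1
      have hN1 : 1 ≤ N := ((le_max_right _ _).trans (le_max_right _ _)).trans hN.1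
      have hNpos : (0 : ℝ) < N := by exact_mod_cast hN1
      set u : ι → X → 𝕜 := fun i => pivotAvg (p i) (L i) (f i) N with hu_def
      have hu : ∀ i, MeasBdd (u i) C := fun i => measBdd_pivotAvg (hL i) hC.le (hf i) N
      set σ : ι → X → 𝕜 := fun i => dualFn (p i) (L i) (u i) N with hσ_def
      have hσ : ∀ i, MeasBdd (σ i) C := fun i => measBdd_dualFn (hL i) hC.le (hu i) N
      have hv1 : ∀ i, MeasBdd (fun y => (C : 𝕜)⁻¹ * u i y) 1 := fun i => by
        have := (hu i).const_mul (C : 𝕜)⁻¹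
        rwa [norm_inv, RCLike.norm_ofReal, abs_of_pos hC, inv_mul_cancel₀ hC.ne'] at this
      have he' : ∑ i, w i * energy μ ((f - σ) i) < r * η := by
        have h1 : ∑ i, w i * energy μ ((f - σ) i) ≤
            ∑ i, w i * energy μ (f i) - ∑ i, w i * energy μ (u i) := by
          rw [← Finset.sum_sub_distrib]
          refine Finset.sum_le_sum fun i _ => ?_
          rw [← mul_sub]
          exact mul_le_mul_of_nonneg_left (energy_sub_dualFn_le (hL i) hC.le (hf i) hN1) (hw i)
        push_cast at he
        linarith
      set R : ι × Fin N → Multiset ((ℤ → G) × (X → 𝕜)) := fun y =>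
        redSys (p y.1) ((y.2 : ℕ) + 1 : ℕ) (fun x => (C : 𝕜)⁻¹ * u y.1 x) (L y.1) with hR
      obtain ⟨M, haM, hFM, g, h, D, hD, hfgh, hg, hh, hgη, hst⟩ := hb₁ ι w p (f - σ) L
        (κ ⊕ (ι × Fin N)) (Sum.elim v fun y => w y.1 * (N : ℝ)⁻¹) (Sum.elim K R)
        hw hwW (fun i => (hf i).sub (hσ i)) hL hadm he'
        (by
          rintro (k | y)
          · exact hv k
          · exact mul_nonneg (hw _) (by positivity))
        (by
          simp only [Fintype.sum_sum_type, Sum.elim_inl, Sum.elim_inr, Fintype.sum_prod_type,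
            Finset.sum_const, Finset.card_univ, Fintype.card_fin, nsmul_eq_mul]
          have : ∀ i, (N : ℝ) * (w i * (N : ℝ)⁻¹) = w i := fun i => by field_simp
          simp only [this]
          exact add_le_add hvV hwW)
        (by
          rintro (k | y)
          · exact hK k
          · exact hadm y.1 _ _ (hv1 y.1))
      refine ⟨M, haM, hFM.trans (le_max_right _ _), g, h + σ, D + C, by linarith, fun i => ?_,
        fun i => (hg i).mono (by linarith), fun i => (hh i).add (hσ i), hgη, ?_⟩
      · rw [Pi.add_apply, ← add_assoc, ← hfgh i]
        simp
      intro l hl l' hl'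
      obtain ⟨hst1, hst2⟩ := hst l hl l' hl'
      simp only [Fintype.sum_sum_type, Sum.elim_inl, Sum.elim_inr, Fintype.sum_prod_type] at hst2
      have hKnn : 0 ≤ ∑ k, v k * energy μ (sysAvg (K k) l - sysAvg (K k) l') :=
        Finset.sum_nonneg fun k _ => mul_nonneg (hv k) (energy_nonneg _)
      have hRnn : 0 ≤ ∑ i, ∑ m : Fin N, w i * (N : ℝ)⁻¹ *
          energy μ (sysAvg (R (i, m)) l - sysAvg (R (i, m)) l') :=
        Finset.sum_nonneg fun i _ => Finset.sum_nonneg fun m _ =>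
          mul_nonneg (mul_nonneg (hw i) (by positivity)) (energy_nonneg _)
      have hδ' : δ / (4 + 8 * C ^ 2) ≤ δ := div_le_self hδ.le (by nlinarith [sq_nonneg C])
      refine ⟨?_, by linarith⟩
      have hlb : l ≤ b₁ := hl.2.trans hFM
      have hlb' : l' ≤ b₁ := hl'.2.trans hFM
      have hσst : ∑ i, w i * energy μ (pivotAvg (p i) (L i) (σ i) l -
          pivotAvg (p i) (L i) (σ i) l') ≤ 2 * (4 * b₁ * C / N) ^ 2 * W +
          2 * C ^ 2 * (δ / (4 + 8 * C ^ 2)) := by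
        calc _ ≤ ∑ i, w i * (2 * (4 * b₁ * C / N) ^ 2 + 2 * C ^ 2 * ((N : ℝ)⁻¹ *
              ∑ m ∈ Finset.range N, energy μ (sysAvg (redSys (p i) (m + 1 : ℕ)
                (fun y => (C : 𝕜)⁻¹ * u i y) (L i)) l - sysAvg (redSys (p i) (m + 1 : ℕ)
                (fun y => (C : 𝕜)⁻¹ * u i y) (L i)) l'))) := by
              refine Finset.sum_le_sum fun i _ => mul_le_mul_of_nonneg_left ?_ (hw i)
              exact energy_pivotAvg_dualFn_sub_le (hL i) hC (hu i) hlb hlb'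
          _ = 2 * (4 * b₁ * C / N) ^ 2 * ∑ i, w i + 2 * C ^ 2 * ∑ i, ∑ m : Fin N,
              w i * (N : ℝ)⁻¹ * energy μ (sysAvg (R (i, m)) l - sysAvg (R (i, m)) l') := by
              rw [Finset.mul_sum, Finset.mul_sum, ← Finset.sum_add_distrib]
              refine Finset.sum_congr rfl fun i _ => ?_
              rw [Finset.sum_range, ← Finset.mul_sum]
              ring
          _ ≤ _ := by
              gcongr
              linarith
      have herr : 2 * (4 * b₁ * C / N) ^ 2 * W ≤ δ / 4 := by
        have h1 : 128 * W * b₁ ^ 2 * C ^ 2 / δ ≤ N := hA.trans (by exact_mod_cast hA0)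
        rw [div_le_iff₀ hδ] at h1
        have h2 : (1 : ℝ) ≤ N := by exact_mod_cast hN1
        have h3 : 128 * W * b₁ ^ 2 * C ^ 2 ≤ N ^ 2 * δ :=
          h1.trans (mul_le_mul_of_nonneg_right (by nlinarith) hδ.le)
        have h4 : 2 * (4 * b₁ * C / N) ^ 2 * W = 128 * W * b₁ ^ 2 * C ^ 2 / N ^ 2 / 4 := by
          field_simp; ring
        rw [h4]
        gcongr
        rw [div_le_iff₀ (by positivity)]
        linarith
      have hsum : ∑ i, w i * energy μ (pivotAvg (p i) (L i) ((h + σ) i) l -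
          pivotAvg (p i) (L i) ((h + σ) i) l') ≤
          2 * ∑ i, w i * energy μ (pivotAvg (p i) (L i) (h i) l - pivotAvg (p i) (L i) (h i) l') +
          2 * ∑ i, w i * energy μ (pivotAvg (p i) (L i) (σ i) l -
            pivotAvg (p i) (L i) (σ i) l') := by
        rw [Finset.mul_sum, Finset.mul_sum, ← Finset.sum_add_distrib]
        refine Finset.sum_le_sum fun i _ => ?_
        have hhN := fun N => measBdd_pivotAvg (p := p i) (hL i) hD (hh i) N
        have hσN := fun N => measBdd_pivotAvg (p := p i) (hL i) hC.le (hσ i) N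
        have h1 := energy_add_le (μ := μ) ((hhN l).sub (hhN l')) ((hσN l).sub (hσN l'))
        rw [Pi.add_apply, pivotAvg_add, pivotAvg_add, add_sub_add_comm]
        nlinarith [hw i]
      have hfin : (2 + 4 * C ^ 2) * (δ / (4 + 8 * C ^ 2)) = δ / 2 := by
        field_simp; ring
      nlinarith

/-- Uniform metastability passes to the next complexity: collect in each system the functions
attached to the pivot, and decompose their products. -/
theorem UniformlyMetastable.succ {d : ℕ} (hd : UniformlyMetastable 𝕜 G μ d) :
    UniformlyMetastable 𝕜 G μ (d + 1) := by
  classical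
  intro W ε hε F a
  obtain ⟨r, hr⟩ := exists_nat_gt (|W| / (ε / 16))
  rw [div_lt_iff₀ (by positivity)] at hr
  obtain ⟨b, hb⟩ := exists_structured_decomposition hd r 1 |W| 0 (ε / 16) (ε / 4) one_pos
    (abs_nonneg W) (by positivity) (by positivity) F a
  refine ⟨b, fun ι _ w L hw hwW hL => ?_⟩
  choose p hp using fun i => (hL i).2
  set L' : ι → Multiset ((ℤ → G) × (X → 𝕜)) := fun i => (L i).filter fun z => z.1 ≠ p i with hL'
  set f : ι → X → 𝕜 := fun i x =>
    (((L i).filter fun z => z.1 = p i).map fun z => z.2 x).prod with hf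
  have hfb : ∀ i, MeasBdd (f i) 1 := fun i => MeasBdd.multiset_prod _ (fun z => z.2)
    fun z hz => (hL i).1 z (Multiset.mem_of_mem_filter hz)
  have hL'b : ∀ i, ∀ z ∈ L' i, MeasBdd z.2 1 := fun i z hz =>
    (hL i).1 z (Multiset.mem_of_mem_filter hz)
  have havg : ∀ i N, sysAvg (L i) N = pivotAvg (p i) (L' i) (f i) N := by
    intro i N
    have : ∀ (n : ℤ) (x : X), sysProd (L i) n x = f i (p i n • x) * sysProd (L' i) n x := by
      intro n x
      simp only [sysProd, hf, hL']
      conv_lhs => rw [← Multiset.filter_add_not (fun z => z.1 = p i) (L i)]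
      rw [Multiset.map_add, Multiset.prod_add]
      congr 2
      refine Multiset.map_congr rfl fun z hz => ?_
      rw [(Multiset.mem_filter.1 hz).2]
    funext x
    simp only [sysAvg, pivotAvg, cesaro, this]
  obtain ⟨M, haM, hFM, g, h, D, hD, hfgh, hg, hh, hgη, hst⟩ := hb ι w p f L' Empty
    (fun _ => 0) (fun _ => 0) hw (hwW.trans (le_abs_self W)) hfb hL'b
    (fun i m u hu => ⟨measBdd_redSys (hL'b i) hu, (hp i m).subset (by
      rintro q ⟨z, hz, rfl⟩
      rcases Multiset.mem_cons.1 hz with rfl | hz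
      · exact Or.inl rfl
      have hmem : ∀ y ∈ L' i, y.1 ∈ {q | ∃ z ∈ L i, z.1 = q} \ {p i} := fun y hy =>
        ⟨⟨y, (Multiset.mem_filter.1 hy).1, rfl⟩, (Multiset.mem_filter.1 hy).2⟩
      rcases Multiset.mem_add.1 hz with hz | hz
      · exact Or.inr (Or.inl (hmem z hz))
      · obtain ⟨y, hy, rfl⟩ := Multiset.mem_map.1 hz
        exact Or.inr (Or.inr ⟨y.1, hmem y hy, rfl⟩))⟩)
    (by
      refine lt_of_le_of_lt ?_ hr
      refine (Finset.sum_le_sum fun i _ => mul_le_mul_of_nonneg_left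
        (energy_le_of_measBdd (hfb i)) (hw i)).trans ?_
      simpa using hwW.trans (le_abs_self W))
    (fun k => k.elim) (by simp) (fun k => k.elim)
  refine ⟨M, haM, hFM, fun N hN N' hN' => ?_⟩
  have h1 := hgη N hN
  have h2 := hgη N' hN'
  have h3 := (hst N hN N' hN').1
  have hsum : ∑ i, w i * energy μ (sysAvg (L i) N - sysAvg (L i) N') ≤
      4 * ∑ i, w i * energy μ (pivotAvg (p i) (L' i) (g i) N) +
      4 * ∑ i, w i * energy μ (pivotAvg (p i) (L' i) (g i) N') +
      2 * ∑ i, w i * energy μ (pivotAvg (p i) (L' i) (h i) N -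
        pivotAvg (p i) (L' i) (h i) N') := by
    rw [Finset.mul_sum, Finset.mul_sum, Finset.mul_sum, ← Finset.sum_add_distrib,
      ← Finset.sum_add_distrib]
    refine Finset.sum_le_sum fun i _ => ?_
    have hgN := fun N => measBdd_pivotAvg (p := p i) (hL'b i) hD (hg i) N
    have hhN := fun N => measBdd_pivotAvg (p := p i) (hL'b i) hD (hh i) N
    have e1 := energy_add_le (μ := μ) ((hgN N).sub (hgN N')) ((hhN N).sub (hhN N'))
    have e2 := energy_sub_le (μ := μ) (hgN N) (hgN N')
    rw [havg, havg, hfgh i, pivotAvg_add, pivotAvg_add, add_sub_add_comm]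
    nlinarith [hw i]
  linarith

theorem uniformlyMetastable (d : ℕ) : UniformlyMetastable 𝕜 G μ d := by
  induction d with
  | zero => exact uniformlyMetastable_zero μ
  | succ d ih => exact ih.succ

/-- The averages of an admissible system form a Cauchy sequence in mean square. -/
theorem exists_forall_energy_sysAvg_sub_le {d : ℕ} {L : Multiset ((ℤ → G) × (X → 𝕜))}
    (hL : IsAdmissible d L) {ε : ℝ} (hε : 0 < ε) :
    ∃ M, ∀ N ≥ M, ∀ N' ≥ M, energy μ (sysAvg L N - sysAvg L N') ≤ ε := by
  by_contra! hcon
  -- choose `F M` beyond a pair witnessing that the averages are not stable after `M`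
  choose A hA B hB hAB using hcon
  obtain ⟨b, hb⟩ := uniformlyMetastable (𝕜 := 𝕜) (G := G) (μ := μ) d 1 ε hε
    (fun M => max (A M) (B M)) 0
  obtain ⟨M, -, -, hM⟩ := hb Unit (fun _ => 1) (fun _ => L) (fun _ => zero_le_one) (by simp)
    (fun _ => hL)
  have := hM (A M) ⟨hA M, le_max_left _ _⟩ (B M) ⟨hB M, le_max_right _ _⟩
  simp only [Finset.univ_unique, Finset.sum_const, Finset.card_singleton, one_smul, one_mul] at this
  exact absurd this (not_le.2 (hAB M))

end Metastable

/-! ### Convergence in `L²` -/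

theorem exists_ae_eq_mul_measBdd {𝕜 X : Type*} [RCLike 𝕜] [MeasurableSpace X] {μ : Measure X}
    {f : X → 𝕜} (hf : MemLp f ∞ μ) :
    ∃ (c : 𝕜) (g : X → 𝕜), MeasBdd g 1 ∧ f =ᵐ[μ] fun x => c * g x := by
  obtain ⟨f₀, hf₀, hff₀⟩ := hf.1
  set C : ℝ := (eLpNorm f ∞ μ).toReal + 1 with hC
  have hC0 : 0 < C := by positivity
  have hC' : (C : 𝕜) ≠ 0 := by exact_mod_cast hC0.ne'
  have hbound : ∀ᵐ x ∂μ, ‖f x‖ ≤ C := by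
    filter_upwards [ae_le_eLpNormEssSup (f := f) (μ := μ)] with x hx
    rw [← eLpNorm_exponent_top] at hx
    have := ENNReal.toReal_mono hf.2.ne hx
    rw [toReal_enorm] at this
    linarith
  refine ⟨C, fun x => if ‖f₀ x‖ ≤ C then (C : 𝕜)⁻¹ * f₀ x else 0, ⟨?_, fun x => ?_⟩, ?_⟩
  · exact Measurable.ite (measurableSet_le hf₀.measurable.norm measurable_const)
      (hf₀.measurable.const_mul _) measurable_const
  · dsimp only
    split_ifs with h
    · rw [norm_mul, norm_inv, RCLike.norm_ofReal, abs_of_pos hC0, inv_mul_le_iff₀ hC0, mul_one]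
      exact h
    · simp
  · filter_upwards [hbound, hff₀] with x hx hx₀
    rw [if_pos (hx₀ ▸ hx), mul_inv_cancel_left₀ hC', hx₀]

theorem MeasBdd.eLpNorm_two {𝕜 X : Type*} [RCLike 𝕜] [MeasurableSpace X] {μ : Measure X}
    [IsFiniteMeasure μ] {f : X → 𝕜} {C : ℝ} (hf : MeasBdd f C) :
    eLpNorm f 2 μ = ENNReal.ofReal (√(energy μ f)) := by
  have hmem : MemLp f 2 μ := MemLp.of_bound hf.1.aestronglyMeasurable C (ae_of_all _ hf.2)
  rw [hmem.eLpNorm_eq_integral_rpow_norm (by norm_num) (by norm_num), Real.sqrt_eq_rpow]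
  simp [energy]

theorem nonconvAverage_ae_eq {𝕜 G X : Type*} [RCLike 𝕜] [Group G] [MeasurableSpace X]
    [MulAction G X] [MeasurableConstSMul G X] {μ : Measure X} [SMulInvariantMeasure G X μ]
    {k : ℕ} (p : Fin k → ℤ → G) {f g : Fin k → X → 𝕜} {c : Fin k → 𝕜}
    (hfg : ∀ i, f i =ᵐ[μ] fun x => c i * g i x) (N : ℕ) :
    nonconvAverage p f N =ᵐ[μ]
      fun x => (∏ i, c i) * sysAvg (Finset.univ.val.map fun i => (p i, g i)) N x := by
  have hae : ∀ᵐ x ∂μ, ∀ (i : Fin k) (n : ℤ), f i (p i n • x) = c i * g i (p i n • x) := by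
    rw [ae_all_iff]; intro i
    rw [ae_all_iff]; intro n
    exact (measurePreserving_smul (p i n) μ).quasiMeasurePreserving.ae (hfg i)
  filter_upwards [hae] with x hx
  have hIcc : ∀ h : ℕ → 𝕜, ∑ n ∈ Finset.Icc 1 N, h n = ∑ n ∈ Finset.range N, h (n + 1) := by
    intro h
    induction N with
    | zero => simp
    | succ N ih => rw [Finset.sum_Icc_succ_top (by omega), Finset.sum_range_succ, ih]
  simp only [nonconvAverage, sysAvg, cesaro, sysProd, hIcc, hx, Finset.prod_mul_distrib,
    Multiset.map_map, Function.comp_def]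
  rw [← Finset.mul_sum, mul_left_comm]
  rfl

theorem theorem1 {𝕜 G X : Type*} [RCLike 𝕜] [Group G] [Countable G] [Group.IsNilpotent G]
    [MeasurableSpace X] [StandardBorelSpace X] [MulAction G X] [MeasurableConstSMul G X]
    (μ : Measure X) [IsProbabilityMeasure μ] [SMulInvariantMeasure G X μ]
    (k : ℕ) (p : Fin k → ℤ → G) (hp : ∀ i, IsPolynomialSeq (p i))
    (f : Fin k → X → 𝕜) (hf : ∀ i, MemLp (f i) ∞ μ) :
    ∃ F : X → 𝕜, MemLp F 2 μ ∧
      Tendsto (fun N : ℕ => eLpNorm (nonconvAverage p f N - F) 2 μ) atTop (𝓝 0) := by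
  obtain ⟨Γ, l, hΓ, hpΓ⟩ := exists_filtration_of_isPolynomialSeq p hp
  obtain ⟨d, hd⟩ := exists_hasComplexity_of_subset_polySet hΓ 0 k
  choose c g hg hfg using fun i => exists_ae_eq_mul_measBdd (hf i)
  set L : Multiset ((ℤ → G) × (X → 𝕜)) := Finset.univ.val.map fun i => (p i, g i) with hL
  have hadm : IsAdmissible d L := by
    constructor
    · intro z hz
      obtain ⟨i, -, rfl⟩ := Multiset.mem_map.1 hz
      exact hg i
    · have hS : {q | ∃ z ∈ L, z.1 = q} = Set.range p := by
        ext q; simp [hL]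
      rw [hS]
      refine hd _ (by rintro _ ⟨i, rfl⟩; exact hpΓ i) ?_
      rw [← Set.image_univ]
      exact (Set.encard_image_le _ _).trans (by simp)
  set C : 𝕜 := ∏ i, c i with hC
  set A : ℕ → X → 𝕜 := fun N x => C * sysAvg L N x with hA
  have hAb : ∀ N, MeasBdd (A N) (‖C‖ * 1) := fun N => (measBdd_sysAvg hadm.1 N).const_mul C
  have hAmem : ∀ N, MemLp (A N) 2 μ := fun N =>
    MemLp.of_bound (hAb N).1.aestronglyMeasurable _ (ae_of_all _ (hAb N).2)
  have hcauchy : CauchySeq fun N => (hAmem N).toLp (A N) := by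
    rw [Metric.cauchySeq_iff]
    intro ε hε
    obtain ⟨M, hM⟩ := exists_forall_energy_sysAvg_sub_le (μ := μ) hadm
      (ε := (ε / (‖C‖ + 1)) ^ 2 / 2) (by positivity)
    refine ⟨M, fun N hN N' hN' => ?_⟩
    rw [dist_eq_norm, ← MemLp.toLp_sub, Lp.norm_toLp, ((hAb N).sub (hAb N')).eLpNorm_two,
      ENNReal.toReal_ofReal (Real.sqrt_nonneg _), Real.sqrt_lt' hε]
    have hsub : A N - A N' = fun x => C * (sysAvg L N - sysAvg L N') x := by
      funext x; simp only [hA, Pi.sub_apply]; ring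
    rw [hsub, energy_const_mul]
    have h1 : ‖C‖ ^ 2 ≤ (‖C‖ + 1) ^ 2 := by gcongr; linarith
    calc ‖C‖ ^ 2 * energy μ (sysAvg L N - sysAvg L N')
        ≤ (‖C‖ + 1) ^ 2 * ((ε / (‖C‖ + 1)) ^ 2 / 2) :=
          mul_le_mul h1 (hM N hN N' hN') (energy_nonneg _) (by positivity)
      _ = ε ^ 2 / 2 := by field_simp
      _ < ε ^ 2 := half_lt_self (by positivity)
  obtain ⟨F, hF⟩ := cauchySeq_tendsto_of_complete hcauchy
  refine ⟨F, Lp.memLp F, ?_⟩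
  rw [Lp.tendsto_Lp_iff_tendsto_eLpNorm'] at hF
  refine hF.congr fun N => eLpNorm_congr_ae ?_
  filter_upwards [(hAmem N).coeFn_toLp, nonconvAverage_ae_eq p hfg N] with x hx hx'
  rw [Pi.sub_apply, Pi.sub_apply, hx, hx']
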